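/- Let $X$ be a compact connected complex manifold of dimension $n\ge 1$, and let $\mathcal K_{2\pi c_1}$ be the set of Kähler forms in the class $2\pi c_1(X)$; assume that $X$ is Fano, i.e. that $\mathcal K_{2\pi c_1}\neq\emptyset$. For $\omega\in\mathcal K_{2\pi c_1}$ let $h_\omega\in C^\infty(X,\mathbb R)$ be its Ricci potential, determined by $\mathrm{Ric}(\omega)=\omega+i\partial\bar\partial h_\omega$ and $\int_X(e^{h_\omega}-1)\,\omega^n=0$, where $\mathrm{Ric}(\omega)$ is the Ricci form. Let $\mathcal P_\omega=\{\varphi\in C^\infty(X,\mathbb R): \omega_\varphi:=\omega+i\partial\bar\partial\varphi>0\}$, and write $V:=\int_X\omega^n$. For $\varphi\in\mathcal P_\omega$ define the K-energy $$\nu_\omega(\varphi)=\frac{1}{V}\int_X\Big(\log\frac{\omega_\varphi^n}{\omega^n}+\varphi-h_\omega\Big)\omega_\varphi^n-\frac1{n+1}\sum_{k=0}^n\frac{1}{V}\int_X\varphi\,\omega^k\wedge\omega_\varphi^{n-k}+\frac{1}{V}\int_X h_\omega\,\omega^n$$ and the Chen–Tian energy $$E_{1,\omega}(\varphi)=\frac{1}{V}\int_X\Big(\log\frac{\omega_\varphi^n}{\omega^n}-h_\omega\Big)\big(\mathrm{Ric}(\omega_\varphi)+\omega\big)\wedge\omega_\varphi^{n-1}+\sum_{k=0}^n\frac{b_k}{n+1}\frac{1}{V}\int_X\varphi\,\omega^k\wedge\omega_\varphi^{n-k}+\frac{1}{V}\int_X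 h_\omega\big(\mathrm{Ric}(\omega)+\omega\big)\wedge\omega^{n-1},$$ where $b_0=b_1=n-1$ and $b_k=-2$ for $k\ge2$. Theorem. If the K-energy of the class $2\pi c_1(X)$ is bounded from below, that is, if $\nu_{\omega_0}$ is bounded from below on $\mathcal P_{\omega_0}$ for some reference form $\omega_0\in\mathcal K_{2\pi c_1}$, then the Chen–Tian energy $E_1$ of the class $2\pi c_1(X)$ is bounded from below: for every $\omega\in\mathcal K_{2\pi c_1}$ there is a constant $C$ with $E_{1,\omega}(\varphi)\ge C$ for all $\varphi\in\mathcal P_\omega$. -/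

import Mathlib

open scoped Manifold ContDiff Matrix ComplexOrder
open MeasureTheory

noncomputable section

namespace FanoEnergy

/-- The model space `ℂⁿ`; its `volume` is Lebesgue measure `∏ⱼ dxⱼ dyⱼ`. -/
abbrev Cn (n : ℕ) : Type := Fin n → ℂ

/-! ### Wirtinger calculus on `ℂⁿ` -/

/-- `∂f/∂zⱼ = (∂f/∂xⱼ - i ∂f/∂yⱼ) / 2`. -/
def dz {n : ℕ} (j : Fin n) (f : Cn n → ℂ) (z : Cn n) : ℂ :=
  (fderiv ℝ f z (Pi.single j 1) - Complex.I * fderiv ℝ f z (Pi.single j Complex.I)) / 2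

/-- `∂f/∂z̄ⱼ = (∂f/∂xⱼ + i ∂f/∂yⱼ) / 2`. -/
def dzbar {n : ℕ} (j : Fin n) (f : Cn n → ℂ) (z : Cn n) : ℂ :=
  (fderiv ℝ f z (Pi.single j 1) + Complex.I * fderiv ℝ f z (Pi.single j Complex.I)) / 2

/-- The matrix `(∂²u/∂zⱼ∂z̄ₖ)ⱼₖ` of a real function, i.e. the coefficients of `i∂∂̄u`. -/
def levi {n : ℕ} (u : Cn n → ℝ) (z : Cn n) : Matrix (Fin n) (Fin n) ℂ :=
  Matrix.of fun j k => dz j (dzbar k fun w => (u w : ℂ)) z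

/-- The wedge product of `n` real `(1,1)`-forms `αₘ = i ∑ⱼₖ (Aₘ)ⱼₖ dzⱼ ∧ dz̄ₖ` on `ℂⁿ`, as a
multiple of Lebesgue measure. Expanding the product, only the terms
`∏ₘ (Aₘ)_{σ(m) τ(m)} i dz_{σ(m)} ∧ dz̄_{τ(m)}` with `σ`, `τ` permutations survive, each equal to
`sign σ * sign τ * ∏ₘ (Aₘ)_{σ(m) τ(m)}` times `∏ⱼ (i dzⱼ ∧ dz̄ⱼ) = 2ⁿ ∏ⱼ dxⱼ dyⱼ`. -/
def wedge {n : ℕ} (A : Fin n → Matrix (Fin n) (Fin n) ℂ) : ℝ :=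
  2 ^ n * (∑ σ : Equiv.Perm (Fin n), ∑ τ : Equiv.Perm (Fin n),
    ((Equiv.Perm.sign σ : ℤ) : ℂ) * ((Equiv.Perm.sign τ : ℤ) : ℂ) *
      ∏ m, A m (σ m) (τ m)).re

/-- The product `α ^ k ∧ β ^ (n - k)` of `(1,1)`-forms, for `k ≤ n`. -/
def wedgePow {n : ℕ} (k : ℕ) (A B : Matrix (Fin n) (Fin n) ℂ) : ℝ :=
  wedge fun m : Fin n => if m.val < k then A else B

/-! ### Forms on a complex manifold, through their coefficients in the charts of the atlas -/

/-- Coefficients of a `(1,1)`-form `i ∑ⱼₖ g_c(z)ⱼₖ dzⱼ ∧ dz̄ₖ` in every chart `c` of the atlas.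
Only the values at points `z` of the target of `c` matter. -/
abbrev Coeffs (n : ℕ) (X : Type*) [TopologicalSpace X] [ChartedSpace (Cn n) X] :=
  atlas (Cn n) X → Cn n → Matrix (Fin n) (Fin n) ℂ

/-- The density, with respect to Lebesgue measure, of a top-degree form in every chart. -/
abbrev TopCoeffs (n : ℕ) (X : Type*) [TopologicalSpace X] [ChartedSpace (Cn n) X] :=
  atlas (Cn n) X → Cn n → ℝ

variable {n : ℕ} {X : Type*} [TopologicalSpace X] [ChartedSpace (Cn n) X]

/-- A function on `X` read in the chart `c`. -/
def inChart (u : X → ℝ) (c : atlas (Cn n) X) : Cn n → ℝ := fun z => u (c.1.symm z)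

/-- The complex Jacobian matrix `(∂wₐ/∂z_b)` at the point `x` of the change of charts from the
coordinates `z = c` to the coordinates `w = c'`. -/
def jacobian (c c' : atlas (Cn n) X) (x : X) : Matrix (Fin n) (Fin n) ℂ :=
  LinearMap.toMatrix' (fderiv ℂ (fun z => c'.1 (c.1.symm z)) (c.1 x) : Cn n →ₗ[ℂ] Cn n)

/-- `g` is the family of coefficients of a Kähler form: it transforms as a `(1,1)`-form, is
smooth, (Hermitian) positive definite and closed. -/
structure IsKahler (g : Coeffs n X) : Prop where
  transform : ∀ (c c' : atlas (Cn n) X) (x : X), x ∈ c.1.source → x ∈ c'.1.source →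
    g c (c.1 x) =
      (jacobian c c' x)ᵀ * g c' (c'.1 x) * (jacobian c c' x).map (starRingEnd ℂ)
  smooth : ∀ (c : atlas (Cn n) X) (j k : Fin n),
    ContDiffOn ℝ ∞ (fun z => g c z j k) c.1.target
  posDef : ∀ (c : atlas (Cn n) X), ∀ z ∈ c.1.target, (g c z).PosDef
  closed : ∀ (c : atlas (Cn n) X), ∀ z ∈ c.1.target, ∀ j k l : Fin n,
    dz l (fun w => g c w j k) z = dz j (fun w => g c w l k) z

/-- The Ricci form `Ric(ω) = -i∂∂̄ log det g`. -/
def ricci (g : Coeffs n X) : Coeffs n X := fun c z =>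
  -levi (fun w => Real.log (g c w).det.re) z

/-- The real `(1,1)`-form `α` is exact: `α = dη` for a smooth real `1`-form
`η = ∑ⱼ (aⱼ dzⱼ + āⱼ dz̄ⱼ)` on `X`. The last two conditions say that the `(2,0)`-part (hence also
the `(0,2)`-part) of `dη` vanishes, and that its `(1,1)`-part is `α`. -/
def IsExact (α : Coeffs n X) : Prop :=
  ∃ a : atlas (Cn n) X → Cn n → Cn n,
    (∀ (c c' : atlas (Cn n) X) (x : X), x ∈ c.1.source → x ∈ c'.1.source →
      a c (c.1 x) = (jacobian c c' x)ᵀ *ᵥ a c' (c'.1 x)) ∧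
    (∀ c : atlas (Cn n) X, ContDiffOn ℝ ∞ (a c) c.1.target) ∧
    (∀ c : atlas (Cn n) X, ∀ z ∈ c.1.target, ∀ j l : Fin n,
      dz l (fun w => a c w j) z = dz j (fun w => a c w l) z) ∧
    ∀ c : atlas (Cn n) X, ∀ z ∈ c.1.target, ∀ j k : Fin n,
      dz j (fun w => starRingEnd ℂ (a c w k)) z - dzbar k (fun w => a c w j) z =
        Complex.I * α c z j k

/-- `ω` is a Kähler form in the de Rham class `2πc₁(X)`. The class `2πc₁(X)` is represented by
the Ricci form of any Kähler metric, in particular by `Ric(ω)`. -/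
structure IsCanonicalKahler (g : Coeffs n X) : Prop where
  kahler : IsKahler g
  mem_class : IsExact fun c z => ricci g c z - g c z

/-- The form `ω_φ = ω + i∂∂̄φ`. -/
def perturb (g : Coeffs n X) (φ : X → ℝ) : Coeffs n X := fun c z =>
  g c z + levi (inChart φ c) z

/-- A smooth real function on `X` (for the underlying real manifold). -/
def IsSmooth (n : ℕ) {X : Type*} [TopologicalSpace X] [ChartedSpace (Cn n) X]
    (u : X → ℝ) : Prop :=
  ContMDiff 𝓘(ℝ, Cn n) 𝓘(ℝ, ℝ) ∞ u

/-- The space of Kähler potentials: smooth real `φ` with `ω + i∂∂̄φ > 0`. -/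
def potentials (g : Coeffs n X) : Set (X → ℝ) :=
  {φ | IsSmooth n φ ∧ ∀ c : atlas (Cn n) X, ∀ z ∈ c.1.target, (perturb g φ c z).PosDef}

/-! ### Integration -/

theorem exists_chartPartition (n : ℕ) (X : Type*) [TopologicalSpace X] [T2Space X]
    [CompactSpace X] [ChartedSpace (Cn n) X] :
    ∃ ρ : PartitionOfUnity (atlas (Cn n) X) X Set.univ,
      ρ.IsSubordinate fun c => c.1.source :=
  PartitionOfUnity.exists_isSubordinate isClosed_univ _ (fun c => c.1.open_source)
    fun x _ => Set.mem_iUnion.2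
      ⟨⟨chartAt (Cn n) x, chart_mem_atlas (Cn n) x⟩, mem_chart_source (Cn n) x⟩

/-- A partition of unity subordinate to the atlas. -/
def chartPartition (n : ℕ) (X : Type*) [TopologicalSpace X] [T2Space X]
    [CompactSpace X] [ChartedSpace (Cn n) X] : PartitionOfUnity (atlas (Cn n) X) X Set.univ :=
  (exists_chartPartition n X).choose

variable [T2Space X] [CompactSpace X]

/-- The integral over `X` of a form of top degree, `∑_c ∫ ρ_c η`. Only finitely many `ρ_c` are
nonzero, and the value does not depend on the partition of unity. -/
def integral (η : TopCoeffs n X) : ℝ :=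
  ∑ᶠ c : atlas (Cn n) X,
    ∫ z in c.1.target, chartPartition n X c (c.1.symm z) * η c z

/-- The average operator `(∫_X ωⁿ)⁻¹ ∫_X η`. -/
def avg (g : Coeffs n X) (η : TopCoeffs n X) : ℝ :=
  (integral fun c z => wedge fun _ => g c z)⁻¹ * integral η

/-- `h` is the Ricci potential of `ω`: `Ric(ω) = ω + i∂∂̄h` and `∫_X (eʰ - 1) ωⁿ = 0`. -/
structure IsRicciPotential (g : Coeffs n X) (h : X → ℝ) : Prop where
  smooth : IsSmooth n h
  ricci_eq : ∀ c : atlas (Cn n) X, ∀ z ∈ c.1.target,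
    ricci g c z = g c z + levi (inChart h c) z
  normalized : integral (fun c z =>
    (Real.exp (inChart h c z) - 1) * wedge fun _ => g c z) = 0

/-! ### The energy functionals -/

/-- `log (ω_φⁿ / ωⁿ)`. -/
def logRatio (g : Coeffs n X) (φ : X → ℝ) (c : atlas (Cn n) X) (z : Cn n) : ℝ :=
  Real.log ((wedge fun _ => perturb g φ c z) / wedge fun _ => g c z)

/-- The average of `φ ωᵏ ∧ ω_φⁿ⁻ᵏ`. -/
def mixedEnergy (g : Coeffs n X) (φ : X → ℝ) (k : ℕ) : ℝ :=
  avg g fun c z => inChart φ c z * wedgePow k (g c z) (perturb g φ c z)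

/-- The K-energy `ν_ω(φ)`, where `h` is the Ricci potential of `ω`. -/
def KEnergy (g : Coeffs n X) (h φ : X → ℝ) : ℝ :=
  avg g (fun c z => (logRatio g φ c z + inChart φ c z - inChart h c z) *
      wedge fun _ => perturb g φ c z)
    - 1 / ((n : ℝ) + 1) * ∑ k ∈ Finset.range (n + 1), mixedEnergy g φ k
    + avg g fun c z => inChart h c z * wedge fun _ => g c z

/-- The coefficients `b₀ = b₁ = n - 1`, `b_k = -2` for `k ≥ 2`. -/
def bCoeff (n k : ℕ) : ℝ := if k ≤ 1 then (n : ℝ) - 1 else -2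

/-- The Chen–Tian energy `E_{1,ω}(φ)`, where `h` is the Ricci potential of `ω`. -/
def E1 (g : Coeffs n X) (h φ : X → ℝ) : ℝ :=
  avg g (fun c z => (logRatio g φ c z - inChart h c z) *
      wedgePow 1 (ricci (perturb g φ) c z + g c z) (perturb g φ c z))
    + ∑ k ∈ Finset.range (n + 1), bCoeff n k / ((n : ℝ) + 1) * mixedEnergy g φ k
    + avg g fun c z => inChart h c z * wedgePow 1 (ricci g c z + g c z) (g c z)

end FanoEnergy

end

/-! Write s = log(ω_φⁿ/ωⁿ) − h + φ (`negRicciPotential`). The equation defining h gives Ric(ω_φ) =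
ω_φ − i∂∂̄s (`ricci_perturb`). The b_k are such that the last sum in E₁ equals the averages of φ
ω_φⁿ and φ ω ∧ ω_φⁿ⁻¹ minus twice the Aubin–Mabuchi term of ν (`sum_bCoeff_mul`). After
substitution, the cross terms ∫ φ i∂∂̄s ∧ ω_φⁿ⁻¹ and ∫ s i∂∂̄φ ∧ ω_φⁿ⁻¹ cancel by symmetry of
integration by parts, and what remains is E₁ = 2ν + const + V⁻¹ ∫ i∂s ∧ ∂̄s ∧ ω_φⁿ⁻¹. The last
integral is nonnegative, so E₁ is bounded below by 2ν up to a constant (`KEnergy_le_E1`).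

It remains to change the reference form. If ω₀ and ω have Ricci potentials, then ω = ω₀ + i∂∂̄ψ with
ψ explicit in those potentials and the logarithm of the volume ratio. For this ψ the function s of
(ω, φ) is the same as that of (ω₀, ψ + φ), and the Aubin–Mabuchi energies add
(`sum_pairing_cocycle`). Hence ν_ω(φ) and ν_{ω₀}(ψ + φ) differ by a constant (`exists_KEnergy_eq`).

Two tools carry the computation. The algebraic one treats the wedge product as a mixed discriminant:
symmetric, multilinear, and nonnegative on semidefinite matrices (`wedge_nonneg`). The analytic one
is Stokes' theorem for ∂(f ∂̄u ∧ Ω) with Ω a product of closed forms (`integral_stokesDensity`):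
closedness removes the derivatives of Ω (`sum_dz_eq`), and a partition of unity reduces to compact
support in one chart. -/

noncomputable section

namespace FanoEnergy

/-! ### Mixed discriminants -/

/-- The complex-valued mixed discriminant (without normalisation) of `n` matrices of size `n`. -/
def mixedDet {n : ℕ} (A : Fin n → Matrix (Fin n) (Fin n) ℂ) : ℂ :=
  ∑ σ : Equiv.Perm (Fin n), ∑ τ : Equiv.Perm (Fin n),
    ((Equiv.Perm.sign σ : ℤ) : ℂ) * ((Equiv.Perm.sign τ : ℤ) : ℂ) * ∏ m, A m (σ m) (τ m)

section MixedDet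

variable {n : ℕ}

theorem wedge_eq_mixedDet (A : Fin n → Matrix (Fin n) (Fin n) ℂ) :
    wedge A = 2 ^ n * (mixedDet A).re := rfl

/-- For fixed τ, the sum over σ is the Leibniz formula for the matrix whose m-th column is the
τ(m)-th column of `A m`. Multiplicativity of `det` then passes to mixed discriminants. -/
theorem mixedDet_eq_sum_det (A : Fin n → Matrix (Fin n) (Fin n) ℂ) :
    mixedDet A = ∑ τ : Equiv.Perm (Fin n), ((Equiv.Perm.sign τ : ℤ) : ℂ) *
      (Matrix.of fun j m => A m j (τ m)).det := by
  rw [mixedDet, Finset.sum_comm]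
  refine Finset.sum_congr rfl fun τ _ => ?_
  rw [Matrix.det_apply', Finset.mul_sum]
  refine Finset.sum_congr rfl fun σ _ => ?_
  simp only [Matrix.of_apply]
  ring

theorem mixedDet_mul_left (P : Matrix (Fin n) (Fin n) ℂ)
    (A : Fin n → Matrix (Fin n) (Fin n) ℂ) :
    mixedDet (fun m => P * A m) = P.det * mixedDet A := by
  rw [mixedDet_eq_sum_det, mixedDet_eq_sum_det, Finset.mul_sum]
  refine Finset.sum_congr rfl fun τ _ => ?_
  have : (Matrix.of fun j m => (P * A m) j (τ m)) = P * Matrix.of fun j m => A m j (τ m) := by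
    ext j m
    simp [Matrix.mul_apply]
  rw [this, Matrix.det_mul]
  ring

theorem mixedDet_transpose (A : Fin n → Matrix (Fin n) (Fin n) ℂ) :
    mixedDet (fun m => (A m)ᵀ) = mixedDet A := by
  rw [mixedDet, mixedDet, Finset.sum_comm]
  refine Finset.sum_congr rfl fun σ _ => Finset.sum_congr rfl fun τ _ => ?_
  simp only [Matrix.transpose_apply]
  ring

theorem mixedDet_mul_right (P : Matrix (Fin n) (Fin n) ℂ)
    (A : Fin n → Matrix (Fin n) (Fin n) ℂ) :
    mixedDet (fun m => A m * P) = P.det * mixedDet A := by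
  rw [← mixedDet_transpose, ← mixedDet_transpose A, ← Matrix.det_transpose P,
    ← mixedDet_mul_left]
  simp only [Matrix.transpose_mul]

theorem mixedDet_conjTranspose (A : Fin n → Matrix (Fin n) (Fin n) ℂ) :
    mixedDet (fun m => (A m)ᴴ) = starRingEnd ℂ (mixedDet A) := by
  rw [mixedDet, mixedDet, Finset.sum_comm, map_sum]
  refine Finset.sum_congr rfl fun σ _ => ?_
  rw [map_sum]
  refine Finset.sum_congr rfl fun τ _ => ?_
  simp only [Matrix.conjTranspose_apply, map_mul, map_prod, map_intCast, starRingEnd_apply]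
  ring

/-- Reindexing σ and τ by the same permutation changes both signs, so the product of signs is
unchanged. This is the commutativity of the wedge product of (1,1)-forms. -/
theorem mixedDet_comp_perm (A : Fin n → Matrix (Fin n) (Fin n) ℂ)
    (π : Equiv.Perm (Fin n)) : mixedDet (fun m => A (π m)) = mixedDet A := by
  rw [mixedDet, mixedDet]
  refine Fintype.sum_equiv (Equiv.mulRight π⁻¹) _ _ fun σ => ?_
  refine Fintype.sum_equiv (Equiv.mulRight π⁻¹) _ _ fun τ => ?_
  have h : ∏ m, A m ((σ * π⁻¹) m) ((τ * π⁻¹) m) = ∏ m, A (π m) (σ m) (τ m) := by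
    rw [← Equiv.prod_comp π]
    simp
  simp only [Equiv.coe_mulRight, h, Equiv.Perm.sign_mul, Equiv.Perm.sign_inv]
  have hs : ((Equiv.Perm.sign π : ℤ) : ℂ) * ((Equiv.Perm.sign π : ℤ) : ℂ) = 1 := by
    rw [← Int.cast_mul, ← Units.val_mul, Int.units_mul_self]
    simp
  push_cast
  linear_combination -((Equiv.Perm.sign σ : ℤ) : ℂ) * ((Equiv.Perm.sign τ : ℤ) : ℂ) *
    (∏ m, A (π m) (σ m) (τ m)) * hs

/-- Isolating the factor in slot `i` makes linearity in that slot visible. -/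
theorem mixedDet_update (A : Fin n → Matrix (Fin n) (Fin n) ℂ) (i : Fin n)
    (M : Matrix (Fin n) (Fin n) ℂ) :
    mixedDet (Function.update A i M) =
      ∑ σ : Equiv.Perm (Fin n), ∑ τ : Equiv.Perm (Fin n),
        ((Equiv.Perm.sign σ : ℤ) : ℂ) * ((Equiv.Perm.sign τ : ℤ) : ℂ) *
          (M (σ i) (τ i) * ∏ m ∈ Finset.univ.erase i, A m (σ m) (τ m)) := by
  rw [mixedDet]
  refine Finset.sum_congr rfl fun σ _ => Finset.sum_congr rfl fun τ _ => ?_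
  rw [← Finset.mul_prod_erase _ _ (Finset.mem_univ i), Function.update_self]
  congr 2
  refine Finset.prod_congr rfl fun m hm => ?_
  rw [Function.update_of_ne (Finset.ne_of_mem_erase hm)]

theorem wedge_update_add (A : Fin n → Matrix (Fin n) (Fin n) ℂ) (i : Fin n)
    (M N : Matrix (Fin n) (Fin n) ℂ) :
    wedge (Function.update A i (M + N)) =
      wedge (Function.update A i M) + wedge (Function.update A i N) := by
  simp only [wedge_eq_mixedDet, mixedDet_update, ← mul_add, ← Complex.add_re,
    ← Finset.sum_add_distrib, Matrix.add_apply, add_mul]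

theorem wedge_update_sub (A : Fin n → Matrix (Fin n) (Fin n) ℂ) (i : Fin n)
    (M N : Matrix (Fin n) (Fin n) ℂ) :
    wedge (Function.update A i (M - N)) =
      wedge (Function.update A i M) - wedge (Function.update A i N) := by
  rw [eq_sub_iff_add_eq, ← wedge_update_add, sub_add_cancel]

theorem wedge_update_swap (A : Fin n → Matrix (Fin n) (Fin n) ℂ) {i j : Fin n}
    (h : A i = A j) (M : Matrix (Fin n) (Fin n) ℂ) :
    wedge (Function.update A i M) = wedge (Function.update A j M) := by
  rw [wedge_eq_mixedDet, wedge_eq_mixedDet, ← mixedDet_comp_perm _ (Equiv.swap i j)]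
  congr 3
  funext m
  by_cases hj : m = j
  · subst hj
    simp
  · rw [Function.update_of_ne hj]
    by_cases hi : m = i
    · subst hi
      rw [Equiv.swap_apply_left, Function.update_of_ne (Ne.symm hj), h]
    · rw [Equiv.swap_apply_of_ne_of_ne hi hj, Function.update_of_ne hi]

theorem mixedDet_const (A : Matrix (Fin n) (Fin n) ℂ) :
    mixedDet (fun _ => A) = n.factorial * A.det := by
  rw [mixedDet_eq_sum_det]
  have : ∀ τ : Equiv.Perm (Fin n), ((Equiv.Perm.sign τ : ℤ) : ℂ) *
      (Matrix.of fun j m => A j (τ m)).det = A.det := fun τ => by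
    have h := Matrix.det_permute' τ A
    rw [show (Matrix.of fun j m => A j (τ m)) = A.submatrix id τ from rfl, h, ← mul_assoc,
      ← Int.cast_mul, ← Units.val_mul, Int.units_mul_self]
    simp
  rw [Finset.sum_congr rfl fun τ _ => this τ, Finset.sum_const, Finset.card_univ,
    Fintype.card_perm, Fintype.card_fin, nsmul_eq_mul]

theorem wedge_const (A : Matrix (Fin n) (Fin n) ℂ) :
    wedge (fun _ => A) = 2 ^ n * n.factorial * A.det.re := by
  rw [wedge_eq_mixedDet, mixedDet_const, ← Complex.ofReal_natCast, Complex.re_ofReal_mul]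
  ring

/-- The factor |det P|² is the real Jacobian determinant of a holomorphic change of coordinates, so
wedge products of (1,1)-forms transform as densities. -/
theorem wedge_transform (P : Matrix (Fin n) (Fin n) ℂ)
    (A : Fin n → Matrix (Fin n) (Fin n) ℂ) :
    wedge (fun m => Pᵀ * A m * P.map (starRingEnd ℂ)) = Complex.normSq P.det * wedge A := by
  rw [wedge_eq_mixedDet, wedge_eq_mixedDet, mixedDet_mul_right, mixedDet_mul_left,
    Matrix.det_transpose, ← mul_assoc,
    show (P.map (starRingEnd ℂ)).det = starRingEnd ℂ P.det from
      ((starRingEnd ℂ).map_det P).symm, mul_comm (starRingEnd ℂ P.det), Complex.mul_conj,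
    Complex.re_ofReal_mul]
  ring

-- Factor each matrix as Q Qᴴ and expand. Each choice κ of one column from every Q contributes the
-- double sum over σ and τ, which splits as a determinant times its conjugate.
open scoped MatrixOrder in
theorem wedge_nonneg {A : Fin n → Matrix (Fin n) (Fin n) ℂ} (hA : ∀ m, (A m).PosSemidef) :
    0 ≤ wedge A := by
  have hQ : ∀ m, ∃ Q : Matrix (Fin n) (Fin n) ℂ, A m = Q * Qᴴ := fun m => by
    obtain ⟨B, hB⟩ := CStarAlgebra.nonneg_iff_eq_star_mul_self.1 (Matrix.nonneg_iff_posSemidef.2 (hA m))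
    exact ⟨Bᴴ, by rw [hB, Matrix.conjTranspose_conjTranspose, Matrix.star_eq_conjTranspose]⟩
  choose Q hQ using hQ
  have key : mixedDet A = ∑ κ : Fin n → Fin n,
      ((Complex.normSq (Matrix.of fun j m => Q m j (κ m)).det : ℝ) : ℂ) := by
    have h1 : ∀ σ τ : Equiv.Perm (Fin n), ∏ m, A m (σ m) (τ m) =
        ∑ κ : Fin n → Fin n, (∏ m, Q m (σ m) (κ m)) *
          starRingEnd ℂ (∏ m, Q m (τ m) (κ m)) := fun σ τ => by
      simp only [hQ, Matrix.mul_apply, Matrix.conjTranspose_apply, Finset.prod_univ_sum,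
        Fintype.piFinset_univ, Finset.prod_mul_distrib, map_prod, starRingEnd_apply]
    simp only [mixedDet, h1, Finset.mul_sum]
    rw [Finset.sum_congr rfl fun σ _ => Finset.sum_comm, Finset.sum_comm]
    refine Finset.sum_congr rfl fun κ _ => ?_
    rw [← Complex.mul_conj, Matrix.det_apply', map_sum, Finset.sum_mul_sum]
    refine Finset.sum_congr rfl fun σ _ => Finset.sum_congr rfl fun τ _ => ?_
    simp only [Matrix.of_apply, map_mul, map_intCast]
    ring
  rw [wedge_eq_mixedDet, key, Complex.re_sum]
  refine mul_nonneg (by positivity) (Finset.sum_nonneg fun κ _ => ?_)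
  rw [Complex.ofReal_re]
  exact Complex.normSq_nonneg _

theorem wedge_conjTranspose (A : Fin n → Matrix (Fin n) (Fin n) ℂ) :
    wedge (fun m => (A m)ᴴ) = wedge A := by
  rw [wedge_eq_mixedDet, wedge_eq_mixedDet, mixedDet_conjTranspose, Complex.conj_re]

end MixedDet

/-! ### Wirtinger calculus -/

section Wirtinger

variable {n : ℕ} {f g : Cn n → ℂ} {z : Cn n}

theorem dz_congr (h : f =ᶠ[nhds z] g) (j : Fin n) : dz j f z = dz j g z := by
  rw [dz, dz, h.fderiv_eq]

theorem dzbar_congr (h : f =ᶠ[nhds z] g) (j : Fin n) : dzbar j f z = dzbar j g z := by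
  rw [dzbar, dzbar, h.fderiv_eq]

theorem dz_add (hf : DifferentiableAt ℝ f z) (hg : DifferentiableAt ℝ g z) (j : Fin n) :
    dz j (fun w => f w + g w) z = dz j f z + dz j g z := by
  simp only [dz, fderiv_fun_add hf hg, add_apply]
  ring

theorem dz_sum {ι : Type*} (s : Finset ι) {F : ι → Cn n → ℂ}
    (hF : ∀ i ∈ s, DifferentiableAt ℝ (F i) z) (j : Fin n) :
    dz j (fun w => ∑ i ∈ s, F i w) z = ∑ i ∈ s, dz j (F i) z := by
  simp only [dz, fderiv_fun_sum hF, sum_apply, Finset.mul_sum,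
    ← Finset.sum_sub_distrib, Finset.sum_div]

theorem dz_mul (hf : DifferentiableAt ℝ f z) (hg : DifferentiableAt ℝ g z) (j : Fin n) :
    dz j (fun w => f w * g w) z = dz j f z * g z + f z * dz j g z := by
  simp only [dz, fderiv_fun_mul hf hg, add_apply,
    smul_apply, smul_eq_mul]
  ring

theorem dz_prod {ι : Type*} [DecidableEq ι] (s : Finset ι) {F : ι → Cn n → ℂ}
    (hF : ∀ i ∈ s, DifferentiableAt ℝ (F i) z) (j : Fin n) :
    dz j (fun w => ∏ i ∈ s, F i w) z =
      ∑ i ∈ s, dz j (F i) z * ∏ l ∈ s.erase i, F l z := by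
  simp only [dz, fderiv_finsetProd hF, sum_apply,
    smul_apply, smul_eq_mul, Finset.mul_sum, ← Finset.sum_sub_distrib,
    Finset.sum_div]
  exact Finset.sum_congr rfl fun i _ => by ring

theorem dzbar_add (hf : DifferentiableAt ℝ f z) (hg : DifferentiableAt ℝ g z) (j : Fin n) :
    dzbar j (fun w => f w + g w) z = dzbar j f z + dzbar j g z := by
  simp only [dzbar, fderiv_fun_add hf hg, add_apply]
  ring

theorem dz_neg (j : Fin n) : dz j (fun w => -f w) z = -dz j f z := by
  simp only [dz, fderiv_fun_neg, neg_apply]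
  ring

theorem dzbar_neg (j : Fin n) : dzbar j (fun w => -f w) z = -dzbar j f z := by
  simp only [dzbar, fderiv_fun_neg, neg_apply]
  ring

theorem dzbar_const (a : ℂ) (j : Fin n) : dzbar j (fun _ => a) z = 0 := by
  simp [dzbar]

theorem dz_const (a : ℂ) (j : Fin n) : dz j (fun _ => a) z = 0 := by
  simp [dz]

theorem fderiv_conj_apply (hf : DifferentiableAt ℝ f z) (v : Cn n) :
    fderiv ℝ (fun w => starRingEnd ℂ (f w)) z v = starRingEnd ℂ (fderiv ℝ f z v) := by
  have h := (Complex.conjCLE.toContinuousLinearMap.hasFDerivAt (x := f z)).comp z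
    hf.hasFDerivAt
  have h2 : (fun w => starRingEnd ℂ (f w)) = (Complex.conjCLE.toContinuousLinearMap : ℂ → ℂ) ∘ f := by
    ext; simp
  rw [h2, h.fderiv]
  simp

theorem conj_dz (hf : DifferentiableAt ℝ f z) (j : Fin n) :
    starRingEnd ℂ (dz j f z) = dzbar j (fun w => starRingEnd ℂ (f w)) z := by
  simp only [dz, dzbar, fderiv_conj_apply hf, map_div₀, map_sub, map_mul, Complex.conj_I,
    map_ofNat]
  ring

theorem conj_dzbar (hf : DifferentiableAt ℝ f z) (j : Fin n) :
    starRingEnd ℂ (dzbar j f z) = dz j (fun w => starRingEnd ℂ (f w)) z := by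
  simp only [dz, dzbar, fderiv_conj_apply hf, map_div₀, map_add, map_mul, Complex.conj_I,
    map_ofNat]
  ring

/-- A vector of `ℂⁿ` in the real basis `∂/∂xⱼ`, `∂/∂yⱼ`. -/
theorem eq_sum_re_im (w : Cn n) :
    w = ∑ a, ((w a).re • (Pi.single a 1 : Cn n) + (w a).im • (Pi.single a Complex.I : Cn n)) := by
  ext b
  simp only [Finset.sum_apply, Pi.add_apply, Pi.smul_apply, Pi.single_apply]
  rw [Finset.sum_eq_single b]
  · simp [Complex.re_add_im]
  · intro a _ hab
    simp [hab.symm]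
  · simp

/-- This is df = ∂f + ∂̄f, the source of both Wirtinger chain rules below. -/
theorem fderiv_apply_eq_sum (w : Cn n) :
    fderiv ℝ f z w = ∑ a, (w a * dz a f z + starRingEnd ℂ (w a) * dzbar a f z) := by
  conv_lhs => rw [eq_sum_re_im w]
  rw [map_sum]
  refine Finset.sum_congr rfl fun a _ => ?_
  rw [map_add, map_smul, map_smul, dz, dzbar, Complex.real_smul, Complex.real_smul]
  have h := Complex.re_add_im (w a)
  have h' : starRingEnd ℂ (w a) = (w a).re - (w a).im * Complex.I := by
    apply Complex.ext <;> simp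
  rw [h']
  conv_rhs => enter [1, 1]; rw [← h]
  linear_combination ((w a).im * fderiv ℝ f z (Pi.single a Complex.I)) * Complex.I_sq

/-! ### Chain rule under holomorphic maps -/

variable {F : Cn n → Cn n}

theorem fderiv_comp_holomorphic (hf : DifferentiableAt ℝ f (F z))
    (hF : DifferentiableAt ℂ F z) (v : Cn n) :
    fderiv ℝ (fun w => f (F w)) z v = fderiv ℝ f (F z) (fderiv ℂ F z v) := by
  have h := hf.hasFDerivAt.comp z (hF.hasFDerivAt.restrictScalars ℝ)
  have h' : fderiv ℝ (fun w => f (F w)) z = _ := h.fderiv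
  rw [h']
  simp

theorem single_I_eq (j : Fin n) :
    (Pi.single j Complex.I : Cn n) = Complex.I • Pi.single j (1 : ℂ) := by
  rw [← Pi.single_smul]
  simp

theorem dz_comp (hf : DifferentiableAt ℝ f (F z)) (hF : DifferentiableAt ℂ F z) (j : Fin n) :
    dz j (fun w => f (F w)) z =
      ∑ a, fderiv ℂ F z (Pi.single j 1) a * dz a f (F z) := by
  rw [dz, fderiv_comp_holomorphic hf hF, fderiv_comp_holomorphic hf hF, single_I_eq, map_smul,
    fderiv_apply_eq_sum, fderiv_apply_eq_sum, Finset.mul_sum, ← Finset.sum_sub_distrib,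
    Finset.sum_div]
  refine Finset.sum_congr rfl fun a _ => ?_
  simp only [Pi.smul_apply, smul_eq_mul, map_mul, Complex.conj_I]
  linear_combination (-(fderiv ℂ F z (Pi.single j 1) a) * dz a f (F z) / 2 +
    starRingEnd ℂ (fderiv ℂ F z (Pi.single j 1) a) * dzbar a f (F z) / 2) * Complex.I_sq

theorem dzbar_comp (hf : DifferentiableAt ℝ f (F z)) (hF : DifferentiableAt ℂ F z)
    (j : Fin n) :
    dzbar j (fun w => f (F w)) z =
      ∑ a, starRingEnd ℂ (fderiv ℂ F z (Pi.single j 1) a) * dzbar a f (F z) := by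
  rw [dzbar, fderiv_comp_holomorphic hf hF, fderiv_comp_holomorphic hf hF, single_I_eq,
    map_smul, fderiv_apply_eq_sum, fderiv_apply_eq_sum, Finset.mul_sum,
    ← Finset.sum_add_distrib, Finset.sum_div]
  refine Finset.sum_congr rfl fun a _ => ?_
  simp only [Pi.smul_apply, smul_eq_mul, map_mul, Complex.conj_I]
  linear_combination ((fderiv ℂ F z (Pi.single j 1) a) * dz a f (F z) / 2 -
    starRingEnd ℂ (fderiv ℂ F z (Pi.single j 1) a) * dzbar a f (F z) / 2) * Complex.I_sq

theorem dzbar_eq_zero_of_holomorphic (hf : DifferentiableAt ℂ f z) (j : Fin n) :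
    dzbar j f z = 0 := by
  rw [dzbar, hf.fderiv_restrictScalars ℝ, single_I_eq]
  simp only [ContinuousLinearMap.coe_restrictScalars', map_smul, smul_eq_mul]
  linear_combination fderiv ℂ f z (Pi.single j 1) / 2 * Complex.I_sq

theorem dz_conj_eq_zero_of_holomorphic (hf : DifferentiableAt ℂ f z) (j : Fin n) :
    dz j (fun w => starRingEnd ℂ (f w)) z = 0 := by
  rw [← conj_dzbar (hf.restrictScalars ℝ), dzbar_eq_zero_of_holomorphic hf, map_zero]

/-! ### Second derivatives and the complex Hessian -/

theorem contDiffAt_fderiv_apply {m : WithTop ℕ∞} (hf : ContDiffAt ℝ (m + 1) f z) (v : Cn n) :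
    ContDiffAt ℝ m (fun w => fderiv ℝ f w v) z :=
  (hf.fderiv_right le_rfl).clm_apply contDiffAt_const

theorem ContDiffAt.dz {m : WithTop ℕ∞} (hf : ContDiffAt ℝ (m + 1) f z) (j : Fin n) :
    ContDiffAt ℝ m (dz j f) z :=
  ((contDiffAt_fderiv_apply hf _).sub
    (contDiffAt_const.mul (contDiffAt_fderiv_apply hf _))).div_const _

theorem ContDiffAt.dzbar {m : WithTop ℕ∞} (hf : ContDiffAt ℝ (m + 1) f z) (j : Fin n) :
    ContDiffAt ℝ m (dzbar j f) z :=
  ((contDiffAt_fderiv_apply hf _).add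
    (contDiffAt_const.mul (contDiffAt_fderiv_apply hf _))).div_const _

theorem fderiv_fderiv_comm (hf : ContDiffAt ℝ 2 f z) (v w : Cn n) :
    fderiv ℝ (fun x => fderiv ℝ f x v) z w = fderiv ℝ (fun x => fderiv ℝ f x w) z v := by
  have hd : DifferentiableAt ℝ (fderiv ℝ f) z :=
    (hf.fderiv_right (m := 1) (by norm_num)).differentiableAt (by norm_num)
  have h : ∀ v w : Cn n, fderiv ℝ (fun x => fderiv ℝ f x v) z w =
      fderiv ℝ (fderiv ℝ f) z w v := fun v w => by
    have := (hd.hasFDerivAt.clm_apply (hasFDerivAt_const v z)).fderiv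
    rw [this]
    simp
  rw [h, h]
  exact (hf.isSymmSndFDerivAt (by simp)) w v

theorem fderiv_dz (hf : ContDiffAt ℝ 2 f z) (j : Fin n) (v : Cn n) :
    fderiv ℝ (dz j f) z v = dz j (fun x => fderiv ℝ f x v) z := by
  have hd : ∀ w : Cn n, DifferentiableAt ℝ (fun x => fderiv ℝ f x w) z := fun w =>
    (contDiffAt_fderiv_apply (m := 1) (by simpa [one_add_one_eq_two] using hf) w).differentiableAt
      (by norm_num)
  have h := ((hd (Pi.single j 1)).hasFDerivAt.sub
    ((hd (Pi.single j Complex.I)).hasFDerivAt.const_mul Complex.I)).mul_const (2 : ℂ)⁻¹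
  have h' : fderiv ℝ (dz j f) z = _ := h.fderiv
  rw [h', dz, fderiv_fderiv_comm hf v, fderiv_fderiv_comm hf v]
  simp [div_eq_inv_mul]

theorem dz_dz_comm (hf : ContDiffAt ℝ 2 f z) (j l : Fin n) :
    dz l (dz j f) z = dz j (dz l f) z := by
  have hd : ∀ w : Cn n, DifferentiableAt ℝ (fun x => fderiv ℝ f x w) z := fun w =>
    (contDiffAt_fderiv_apply (m := 1) (by simpa [one_add_one_eq_two] using hf) w).differentiableAt
      (by norm_num)
  rw [dz, fderiv_dz hf, fderiv_dz hf]
  have h : HasFDerivAt (dz l f) _ z := ((hd (Pi.single l 1)).hasFDerivAt.sub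
    ((hd (Pi.single l Complex.I)).hasFDerivAt.const_mul Complex.I)).mul_const (2 : ℂ)⁻¹
  rw [dz, dz, dz, h.fderiv]
  simp
  ring

theorem dz_dzbar_comm (hf : ContDiffAt ℝ 2 f z) (j l : Fin n) :
    dz l (dzbar j f) z = dzbar j (dz l f) z := by
  have hd : ∀ w : Cn n, DifferentiableAt ℝ (fun x => fderiv ℝ f x w) z := fun w =>
    (contDiffAt_fderiv_apply (m := 1) (by simpa [one_add_one_eq_two] using hf) w).differentiableAt
      (by norm_num)
  rw [dzbar, fderiv_dz hf, fderiv_dz hf]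
  have h : HasFDerivAt (dzbar j f) _ z := ((hd (Pi.single j 1)).hasFDerivAt.add
    ((hd (Pi.single j Complex.I)).hasFDerivAt.const_mul Complex.I)).mul_const (2 : ℂ)⁻¹
  rw [dz, dz, dz, h.fderiv]
  simp
  ring

theorem contDiffAt_ofReal {m : WithTop ℕ∞} {u : Cn n → ℝ} (hu : ContDiffAt ℝ m u z) :
    ContDiffAt ℝ m (fun w => (u w : ℂ)) z :=
  Complex.ofRealCLM.contDiff.contDiffAt.comp z hu

theorem levi_congr {u v : Cn n → ℝ} (h : u =ᶠ[nhds z] v) : levi u z = levi v z := by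
  ext j k
  refine dz_congr ?_ j
  filter_upwards [eventually_eventually_nhds.2 h] with w hw
  exact dzbar_congr (hw.mono fun x hx => by simp [hx]) k

theorem levi_add {u v : Cn n → ℝ} (hu : ContDiffAt ℝ 2 u z) (hv : ContDiffAt ℝ 2 v z) :
    levi (fun w => u w + v w) z = levi u z + levi v z := by
  ext j k
  have hu' := contDiffAt_ofReal hu
  have hv' := contDiffAt_ofReal hv
  have hd : ∀ {f : Cn n → ℂ}, ContDiffAt ℝ 2 f z → DifferentiableAt ℝ (dzbar k f) z :=
    fun hf => (ContDiffAt.dzbar (m := 1) (by simpa [one_add_one_eq_two] using hf) k).differentiableAt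
      (by norm_num)
  rw [Matrix.add_apply]
  refine Eq.trans (dz_congr ?_ j) (dz_add (hd hu') (hd hv') j)
  filter_upwards [hu'.eventually (by simp), hv'.eventually (by simp)] with w h1 h2
  simp only [Complex.ofReal_add]
  exact dzbar_add (h1.differentiableAt (by norm_num)) (h2.differentiableAt (by norm_num)) k

theorem levi_neg (u : Cn n → ℝ) : levi (fun w => -u w) z = -levi u z := by
  ext j k
  simp only [levi, Matrix.of_apply, Matrix.neg_apply, Complex.ofReal_neg]
  rw [show dzbar k (fun w => -(u w : ℂ)) = fun w => -dzbar k (fun w => (u w : ℂ)) w from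
    funext fun w => dzbar_neg k, dz_neg]

theorem levi_isHermitian {u : Cn n → ℝ} (hu : ContDiffAt ℝ 2 u z) : (levi u z).IsHermitian := by
  ext j k
  have hu' := contDiffAt_ofReal hu
  have hd : DifferentiableAt ℝ (dzbar j fun w => (u w : ℂ)) z :=
    (ContDiffAt.dzbar (m := 1) (by simpa [one_add_one_eq_two] using hu') j).differentiableAt
      (by norm_num)
  rw [Matrix.conjTranspose_apply, ← starRingEnd_apply]
  simp only [levi, Matrix.of_apply]
  rw [conj_dz hd, dz_dzbar_comm hu']
  refine dzbar_congr ?_ k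
  filter_upwards [hu'.eventually (by simp)] with w h1
  rw [conj_dzbar (h1.differentiableAt (by norm_num))]
  simp

/-- The ∂-derivatives commute on ∂̄ₖu; this is the closedness of i∂∂̄u. -/
theorem dz_levi_comm {u : Cn n → ℝ} (hu : ContDiffAt ℝ 3 u z) (j k l : Fin n) :
    dz l (fun w => levi u w j k) z = dz j (fun w => levi u w l k) z := by
  have hu' := contDiffAt_ofReal hu
  exact dz_dz_comm (ContDiffAt.dzbar (m := 2) (by simpa [two_add_one_eq_three] using hu') k) j l

/-- The coefficients `(∂f/∂zⱼ ∂u/∂z̄ₖ)ⱼₖ` of `i∂f ∧ ∂̄u`, for real functions `f` and `u`. -/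
def gradMatrix (f u : Cn n → ℝ) (z : Cn n) : Matrix (Fin n) (Fin n) ℂ :=
  Matrix.of fun j k => dz j (fun w => (f w : ℂ)) z * dzbar k (fun w => (u w : ℂ)) z

theorem gradMatrix_conjTranspose {f u : Cn n → ℝ} (hf : DifferentiableAt ℝ f z)
    (hu : DifferentiableAt ℝ u z) : (gradMatrix f u z)ᴴ = gradMatrix u f z := by
  have h : ∀ {u : Cn n → ℝ}, DifferentiableAt ℝ u z →
      DifferentiableAt ℝ (fun w => (u w : ℂ)) z := fun hu =>
    Complex.ofRealCLM.differentiableAt.comp z hu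
  ext j k
  rw [Matrix.conjTranspose_apply, ← starRingEnd_apply]
  simp only [gradMatrix, Matrix.of_apply, map_mul]
  rw [conj_dz (h hf), conj_dzbar (h hu)]
  simp only [Complex.conj_ofReal]
  ring

/-- Since u is real, the matrix is the rank-one v v* with v = ∂u. -/
theorem gradMatrix_posSemidef {u : Cn n → ℝ} (hu : DifferentiableAt ℝ u z) :
    (gradMatrix u u z).PosSemidef := by
  have h : gradMatrix u u z = Matrix.vecMulVec (fun j => dz j (fun w => (u w : ℂ)) z)
      (star fun j => dz j (fun w => (u w : ℂ)) z) := by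
    have h : DifferentiableAt ℝ (fun w => (u w : ℂ)) z :=
      Complex.ofRealCLM.differentiableAt.comp z hu
    ext j k
    simp only [gradMatrix, Matrix.of_apply, Matrix.vecMulVec_apply, Pi.star_apply]
    rw [← starRingEnd_apply, conj_dz h]
    simp
  rw [h]
  exact Matrix.posSemidef_vecMulVec_self_star _

/-- The complex Jacobian matrix `(∂Fₐ/∂z_b)`. -/
def jacobianMatrix (F : Cn n → Cn n) (z : Cn n) : Matrix (Fin n) (Fin n) ℂ :=
  LinearMap.toMatrix' (fderiv ℂ F z : Cn n →ₗ[ℂ] Cn n)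

theorem jacobianMatrix_apply (F : Cn n → Cn n) (z : Cn n) (a b : Fin n) :
    jacobianMatrix F z a b = fderiv ℂ F z (Pi.single b 1) a := by
  rw [jacobianMatrix, LinearMap.toMatrix'_apply]
  congr 2

theorem gradMatrix_comp {f u : Cn n → ℝ} (hF : DifferentiableAt ℂ F z)
    (hf : DifferentiableAt ℝ f (F z)) (hu : DifferentiableAt ℝ u (F z)) :
    gradMatrix (fun w => f (F w)) (fun w => u (F w)) z =
      (jacobianMatrix F z)ᵀ * gradMatrix f u (F z) *
        (jacobianMatrix F z).map (starRingEnd ℂ) := by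
  have h : ∀ {u : Cn n → ℝ}, DifferentiableAt ℝ u (F z) →
      DifferentiableAt ℝ (fun w => (u w : ℂ)) (F z) := fun hu =>
    Complex.ofRealCLM.differentiableAt.comp _ hu
  ext j k
  simp only [gradMatrix, Matrix.of_apply, Matrix.mul_apply, Matrix.transpose_apply,
    Matrix.map_apply, jacobianMatrix_apply]
  rw [dz_comp (h hf) hF, dzbar_comp (h hu) hF, Finset.sum_mul_sum, Finset.sum_comm]
  refine Finset.sum_congr rfl fun b _ => ?_
  rw [Finset.sum_mul]
  exact Finset.sum_congr rfl fun a _ => by ring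

/-- No second derivative of `F` survives: after ∂̄ the coefficients are conjugates of holomorphic
functions, which ∂ annihilates. -/
theorem levi_comp {u : Cn n → ℝ} (hF : ContDiffAt ℂ 2 F z) (hu : ContDiffAt ℝ 2 u (F z)) :
    levi (fun w => u (F w)) z =
      (jacobianMatrix F z)ᵀ * levi u (F z) * (jacobianMatrix F z).map (starRingEnd ℂ) := by
  have hu' := contDiffAt_ofReal hu
  have hFd : DifferentiableAt ℂ F z := hF.differentiableAt (by norm_num)
  have hd : ∀ b, DifferentiableAt ℝ (dzbar b fun w => (u w : ℂ)) (F z) := fun b =>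
    (ContDiffAt.dzbar (m := 1) (by simpa [one_add_one_eq_two] using hu') b).differentiableAt
      (by norm_num)
  have hdF : ∀ b, DifferentiableAt ℝ (fun w => dzbar b (fun x => (u x : ℂ)) (F w)) z := fun b =>
    (hd b).comp z (hFd.restrictScalars ℝ)
  have hJ : ∀ k b, DifferentiableAt ℂ (fun w => fderiv ℂ F w (Pi.single k 1) b) z :=
    fun k b => by
      have h1 : DifferentiableAt ℂ (fderiv ℂ F) z :=
        (hF.fderiv_right (m := 1) (by norm_num)).differentiableAt (by norm_num)
      exact differentiableAt_pi.1 (h1.clm_apply (differentiableAt_const _)) b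
  have hJ' : ∀ k b, DifferentiableAt ℝ
      (fun w => starRingEnd ℂ (fderiv ℂ F w (Pi.single k 1) b)) z := fun k b =>
    (Complex.conjCLE.differentiableAt (𝕜 := ℝ)).comp z ((hJ k b).restrictScalars ℝ)
  ext j k
  have key : levi (fun w => u (F w)) z j k =
      dz j (fun w => ∑ b, starRingEnd ℂ (fderiv ℂ F w (Pi.single k 1) b) *
        dzbar b (fun x => (u x : ℂ)) (F w)) z := by
    refine dz_congr ?_ j
    filter_upwards [hF.eventually (by simp),
      hF.continuousAt.eventually (hu'.eventually (by simp))] with w h1 h2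
    exact dzbar_comp (f := fun x => (u x : ℂ)) (h2.differentiableAt (by norm_num))
      (h1.differentiableAt (by norm_num)) k
  rw [key, dz_sum _ fun b _ => (hJ' k b).fun_mul (hdF b)]
  simp only [Matrix.mul_apply, Matrix.transpose_apply, Matrix.map_apply, jacobianMatrix_apply]
  refine Finset.sum_congr rfl fun b _ => ?_
  rw [dz_mul (hJ' k b) (hdF b), dz_conj_eq_zero_of_holomorphic (hJ k b), zero_mul, zero_add,
    dz_comp (hd b) hFd, mul_comm]
  rfl

end Wirtinger

/-! ### Changes of charts -/

section Charts

variable {n : ℕ} {X : Type*} [TopologicalSpace X] [ChartedSpace (Cn n) X]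

theorem jacobian_eq_jacobianMatrix (c c' : atlas (Cn n) X) (x : X) :
    jacobian c c' x = jacobianMatrix (fun z => c'.1 (c.1.symm z)) (c.1 x) := rfl

theorem contDiffAt_transition [IsManifold 𝓘(ℂ, Cn n) ω X] (c c' : atlas (Cn n) X) {x : X}
    (hx : x ∈ c.1.source) (hx' : x ∈ c'.1.source) :
    ContDiffAt ℂ ω (fun z => c'.1 (c.1.symm z)) (c.1 x) := by
  have h := ModelWithCorners.contDiffOn_extendCoordChange (I := 𝓘(ℂ, Cn n)) (n := ω)
    (IsManifold.subset_maximalAtlas c.2) (IsManifold.subset_maximalAtlas c'.2)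
  refine h.contDiffAt ?_
  rw [ModelWithCorners.extendCoordChange_source]
  simpa using (c.1.symm.trans c'.1).open_source.mem_nhds (x := c.1 x) (by simp [hx, hx'])

/-- Gives access to the real smooth theory, in particular to smooth partitions of unity. -/
theorem isManifold_real [IsManifold 𝓘(ℂ, Cn n) ω X] : IsManifold 𝓘(ℝ, Cn n) ∞ X := by
  refine isManifold_of_contDiffOn _ _ _ fun e e' he he' z hz => ?_
  simp only [mfld_simps] at hz
  have h := contDiffAt_transition (X := X) ⟨e, he⟩ ⟨e', he'⟩ (e.map_target hz.1) hz.2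
  rw [e.right_inv hz.1] at h
  exact ((h.restrict_scalars ℝ).of_le le_top).contDiffWithinAt

theorem isSmooth_iff [IsManifold 𝓘(ℂ, Cn n) ω X] {u : X → ℝ} :
    IsSmooth n u ↔ ∀ c : atlas (Cn n) X, ContDiffOn ℝ ∞ (inChart u c) c.1.target := by
  have := isManifold_real (n := n) (X := X)
  constructor
  · intro hu c
    exact contMDiffOn_iff_contDiffOn.1 (ContMDiff.comp_contMDiffOn hu
      (contMDiffOn_symm_of_mem_maximalAtlas (IsManifold.subset_maximalAtlas c.2)))
  · intro hu x
    let c : atlas (Cn n) X := ⟨chartAt (Cn n) x, chart_mem_atlas (Cn n) x⟩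
    have hx : x ∈ c.1.source := mem_chart_source (Cn n) x
    have h1 : ContMDiffAt 𝓘(ℝ, Cn n) 𝓘(ℝ, ℝ) ∞ (inChart u c) (c.1 x) :=
      contMDiffAt_iff_contDiffAt.2
        ((hu c).contDiffAt (c.1.open_target.mem_nhds (c.1.map_source hx)))
    refine (h1.comp x (contMDiffAt_of_mem_maximalAtlas
      (IsManifold.subset_maximalAtlas c.2) hx)).congr_of_eventuallyEq ?_
    filter_upwards [c.1.open_source.mem_nhds hx] with y hy
    simp [inChart, c.1.left_inv hy]

theorem IsSmooth.continuous {u : X → ℝ} (hu : IsSmooth n u) : Continuous u :=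
  ContMDiff.continuous hu

theorem IsSmooth.add {u v : X → ℝ} (hu : IsSmooth n u) (hv : IsSmooth n v) :
    IsSmooth n fun x => u x + v x := ContMDiff.add hu hv

theorem IsSmooth.sub {u v : X → ℝ} (hu : IsSmooth n u) (hv : IsSmooth n v) :
    IsSmooth n fun x => u x - v x := ContMDiff.sub hu hv

theorem isSmooth_const (a : ℝ) : IsSmooth n fun _ : X => a := contMDiff_const

theorem IsSmooth.contDiffAt [IsManifold 𝓘(ℂ, Cn n) ω X] {u : X → ℝ} (hu : IsSmooth n u)
    (c : atlas (Cn n) X) {z : Cn n} (hz : z ∈ c.1.target) :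
    ContDiffAt ℝ ∞ (inChart u c) z :=
  (isSmooth_iff.1 hu c).contDiffAt (c.1.open_target.mem_nhds hz)

theorem inChart_eventuallyEq (u : X → ℝ) (c c' : atlas (Cn n) X) {x : X}
    (hx : x ∈ c.1.source) (hx' : x ∈ c'.1.source) :
    inChart u c =ᶠ[nhds (c.1 x)] fun z => inChart u c' (c'.1 (c.1.symm z)) := by
  have h : c.1.symm.source ∩ c.1.symm ⁻¹' c'.1.source ∈ nhds (c.1 x) :=
    (c.1.symm.isOpen_inter_preimage c'.1.open_source).mem_nhds (by simp [hx, hx'])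
  filter_upwards [h] with z hz
  simp [inChart, c'.1.left_inv hz.2]

/-- The family `g` obeys the transformation law of `(1,1)`-forms. -/
def Transforms (g : Coeffs n X) : Prop :=
  ∀ (c c' : atlas (Cn n) X) (x : X), x ∈ c.1.source → x ∈ c'.1.source →
    g c (c.1 x) =
      (jacobian c c' x)ᵀ * g c' (c'.1 x) * (jacobian c c' x).map (starRingEnd ℂ)

/-- `g` is a continuous `(1,1)`-form. -/
structure IsContinuousForm (g : Coeffs n X) : Prop where
  transform : Transforms g
  continuousOn : ∀ (c : atlas (Cn n) X) (j k : Fin n),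
    ContinuousOn (fun z => g c z j k) c.1.target

/-- `g` is a smooth closed real `(1,1)`-form. -/
structure IsClosedForm (g : Coeffs n X) : Prop where
  transform : Transforms g
  smooth : ∀ (c : atlas (Cn n) X) (j k : Fin n),
    ContDiffOn ℝ ∞ (fun z => g c z j k) c.1.target
  isHermitian : ∀ (c : atlas (Cn n) X), ∀ z ∈ c.1.target, (g c z).IsHermitian
  closed : ∀ (c : atlas (Cn n) X), ∀ z ∈ c.1.target, ∀ j k l : Fin n,
    dz l (fun w => g c w j k) z = dz j (fun w => g c w l k) z

theorem IsKahler.isClosedForm {g : Coeffs n X} (hg : IsKahler g) : IsClosedForm g where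
  transform := hg.transform
  smooth := hg.smooth
  isHermitian c z hz := (hg.posDef c z hz).isHermitian
  closed := hg.closed

theorem IsClosedForm.isContinuousForm {g : Coeffs n X} (hg : IsClosedForm g) :
    IsContinuousForm g where
  transform := hg.transform
  continuousOn c j k := (hg.smooth c j k).continuousOn

/-- The form `i∂∂̄u`. -/
def ddbar (u : X → ℝ) : Coeffs n X := fun c z => levi (inChart u c) z

/-- The form `i∂f ∧ ∂̄u`. -/
def gradForm (f u : X → ℝ) : Coeffs n X := fun c z => gradMatrix (inChart f c) (inChart u c) z

/-! ### Ratios of volume forms -/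

theorem IsKahler.det_re_pos {g : Coeffs n X} (hg : IsKahler g) (c : atlas (Cn n) X) {z : Cn n}
    (hz : z ∈ c.1.target) : 0 < (g c z).det.re :=
  (Complex.pos_iff.1 (hg.posDef c z hz).det_pos).1

theorem Transforms.det_re {g : Coeffs n X} (hg : Transforms g) {c c' : atlas (Cn n) X} {x : X}
    (hx : x ∈ c.1.source) (hx' : x ∈ c'.1.source) :
    (g c (c.1 x)).det.re = Complex.normSq (jacobian c c' x).det * (g c' (c'.1 x)).det.re := by
  rw [hg c c' x hx hx', Matrix.det_mul, Matrix.det_mul, Matrix.det_transpose,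
    show ((jacobian c c' x).map (starRingEnd ℂ)).det = starRingEnd ℂ (jacobian c c' x).det from
      ((starRingEnd ℂ).map_det _).symm, mul_right_comm, Complex.mul_conj, Complex.re_ofReal_mul]

/-- The function `log (ω'ⁿ / ωⁿ)` on `X`. -/
def logVolumeRatio (g g' : Coeffs n X) (x : X) : ℝ :=
  Real.log ((g' ⟨chartAt (Cn n) x, chart_mem_atlas (Cn n) x⟩ (chartAt (Cn n) x x)).det.re /
    (g ⟨chartAt (Cn n) x, chart_mem_atlas (Cn n) x⟩ (chartAt (Cn n) x x)).det.re)

/-- Both determinants scale by the same nonzero |det J|² under a change of charts, so their ratio,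
defined with the preferred chart at each point, can be read in any chart. -/
theorem inChart_logVolumeRatio {g g' : Coeffs n X} (hg : IsKahler g) (hg' : IsKahler g')
    (c : atlas (Cn n) X) {z : Cn n} (hz : z ∈ c.1.target) :
    inChart (logVolumeRatio g g') c z =
      Real.log (g' c z).det.re - Real.log (g c z).det.re := by
  rw [← Real.log_div (hg'.det_re_pos c hz).ne' (hg.det_re_pos c hz).ne', inChart,
    logVolumeRatio]
  congr 1
  set x := c.1.symm z
  have hxc : x ∈ c.1.source := c.1.map_target hz
  have hz' : c.1 x = z := c.1.right_inv hz
  let c' : atlas (Cn n) X := ⟨chartAt (Cn n) x, chart_mem_atlas (Cn n) x⟩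
  have hxc' : x ∈ c'.1.source := mem_chart_source (Cn n) x
  have h1 := hg.det_re_pos c hz
  have e1 := Transforms.det_re hg.transform hxc hxc'
  have e2 := Transforms.det_re hg'.transform hxc hxc'
  rw [hz'] at e1 e2
  have hJ : Complex.normSq (jacobian c c' x).det ≠ 0 := fun h => by
    rw [e1, h, zero_mul] at h1
    exact h1.ne rfl
  rw [e1, e2, mul_div_mul_left _ _ hJ]

theorem IsKahler.contDiffOn_log_det {g : Coeffs n X} (hg : IsKahler g) (c : atlas (Cn n) X) :
    ContDiffOn ℝ ∞ (fun z => Real.log (g c z).det.re) c.1.target := by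
  refine ContDiffOn.log ?_ fun z hz => (hg.det_re_pos c hz).ne'
  refine Complex.reCLM.contDiff.comp_contDiffOn ?_
  simp only [Matrix.det_apply']
  exact ContDiffOn.sum fun σ _ => contDiffOn_const.mul
    (contDiffOn_prod fun i _ => hg.smooth c _ _)

theorem logRatio_eq {g : Coeffs n X} (hg : IsKahler g) {φ : X → ℝ}
    (hg' : IsKahler (perturb g φ)) (c : atlas (Cn n) X) {z : Cn n} (hz : z ∈ c.1.target) :
    logRatio g φ c z = inChart (logVolumeRatio g (perturb g φ)) c z := by
  rw [inChart_logVolumeRatio hg hg' c hz,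
    ← Real.log_div (hg'.det_re_pos c hz).ne' (hg.det_re_pos c hz).ne', logRatio, wedge_const,
    wedge_const, mul_div_mul_left]
  positivity

/-- Each log det is only local, but the difference is a global function; this turns a difference of
Ricci forms into i∂∂̄ of it. -/
theorem ddbar_logVolumeRatio {g g' : Coeffs n X} (hg : IsKahler g) (hg' : IsKahler g')
    (c : atlas (Cn n) X) {z : Cn n} (hz : z ∈ c.1.target) :
    ddbar (logVolumeRatio g g') c z = ricci g c z - ricci g' c z := by
  have hnhds := c.1.open_target.mem_nhds hz
  have h : ∀ {g : Coeffs n X}, IsKahler g →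
      ContDiffAt ℝ 2 (fun z => Real.log (g c z).det.re) z := fun hg =>
    ((hg.contDiffOn_log_det c).contDiffAt hnhds).of_le ENat.LEInfty.out
  have e : inChart (logVolumeRatio g g') c =ᶠ[nhds z]
      fun w => Real.log (g' c w).det.re + -Real.log (g c w).det.re := by
    filter_upwards [hnhds] with w hw
    rw [inChart_logVolumeRatio hg hg' c hw, sub_eq_add_neg]
  rw [ddbar, levi_congr e, levi_add (h hg') (h hg).neg, levi_neg, ricci, ricci]
  abel

theorem IsClosedForm.add {g g' : Coeffs n X} (hg : IsClosedForm g) (hg' : IsClosedForm g') :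
    IsClosedForm fun c z => g c z + g' c z where
  transform c c' x hx hx' := by
    beta_reduce
    rw [hg.transform c c' x hx hx', hg'.transform c c' x hx hx', Matrix.mul_add, Matrix.add_mul]
  smooth c j k := (hg.smooth c j k).add (hg'.smooth c j k)
  isHermitian c z hz := (hg.isHermitian c z hz).add (hg'.isHermitian c z hz)
  closed c z hz j k l := by
    have hd : ∀ {g : Coeffs n X}, IsClosedForm g → ∀ j k,
        DifferentiableAt ℝ (fun w => g c w j k) z := fun hg j k =>
      ((hg.smooth c j k).contDiffAt (c.1.open_target.mem_nhds hz)).differentiableAt (by simp)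
    simp only [Matrix.add_apply]
    rw [dz_add (hd hg _ _) (hd hg' _ _), dz_add (hd hg _ _) (hd hg' _ _),
      hg.closed c z hz, hg'.closed c z hz]

/-! ### Forms built from smooth functions -/

variable [IsManifold 𝓘(ℂ, Cn n) ω X]

theorem isClosedForm_ddbar {u : X → ℝ} (hu : IsSmooth n u) :
    IsClosedForm (ddbar u : Coeffs n X) where
  transform c c' x hx hx' := by
    simp only [ddbar]
    rw [levi_congr (inChart_eventuallyEq u c c' hx hx'), levi_comp, jacobian_eq_jacobianMatrix,
      c.1.left_inv hx]
    · exact (contDiffAt_transition c c' hx hx').of_le le_top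
    · rw [c.1.left_inv hx]
      exact (hu.contDiffAt c' (c'.1.map_source hx')).of_le ENat.LEInfty.out
  smooth c j k z hz := by
    have h := contDiffAt_ofReal (hu.contDiffAt c hz)
    exact (ContDiffAt.dz (m := ∞) (ContDiffAt.dzbar (m := ∞) h k) j).contDiffWithinAt
  isHermitian c z hz := levi_isHermitian
    ((hu.contDiffAt c hz).of_le ENat.LEInfty.out)
  closed c z hz j k l := dz_levi_comm
    ((hu.contDiffAt c hz).of_le ENat.LEInfty.out) j k l

theorem isContinuousForm_gradForm {f u : X → ℝ} (hf : IsSmooth n f) (hu : IsSmooth n u) :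
    IsContinuousForm (gradForm f u : Coeffs n X) where
  transform c c' x hx hx' := by
    have h : ∀ {u : X → ℝ}, IsSmooth n u →
        DifferentiableAt ℝ (inChart u c') (c'.1 (c.1.symm (c.1 x))) := fun hu => by
      rw [c.1.left_inv hx]
      exact (hu.contDiffAt c' (c'.1.map_source hx')).differentiableAt (by simp)
    have e : gradMatrix (inChart f c) (inChart u c) (c.1 x) =
        gradMatrix (fun z => inChart f c' (c'.1 (c.1.symm z)))
          (fun z => inChart u c' (c'.1 (c.1.symm z))) (c.1 x) := by
      ext j k
      exact congrArg₂ (· * ·)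
        (dz_congr ((inChart_eventuallyEq f c c' hx hx').mono fun z hz => by simp [hz]) j)
        (dzbar_congr ((inChart_eventuallyEq u c c' hx hx').mono fun z hz => by simp [hz]) k)
    simp only [gradForm]
    rw [e, gradMatrix_comp ((contDiffAt_transition c c' hx hx').differentiableAt (by simp))
      (h hf) (h hu), jacobian_eq_jacobianMatrix, c.1.left_inv hx]
  continuousOn c j k z hz := by
    have h1 := contDiffAt_ofReal (hf.contDiffAt c hz)
    have h2 := contDiffAt_ofReal (hu.contDiffAt c hz)
    exact ((ContDiffAt.dz (m := ∞) h1 j).continuousAt.mul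
      (ContDiffAt.dzbar (m := ∞) h2 k).continuousAt).continuousWithinAt

theorem isKahler_perturb {g : Coeffs n X} (hg : IsKahler g) {φ : X → ℝ}
    (hφ : φ ∈ potentials g) : IsKahler (perturb g φ) := by
  have h := hg.isClosedForm.add (isClosedForm_ddbar hφ.1)
  exact ⟨h.transform, h.smooth, hφ.2, h.closed⟩

theorem isSmooth_logVolumeRatio {g g' : Coeffs n X} (hg : IsKahler g) (hg' : IsKahler g') :
    IsSmooth n (logVolumeRatio g g') :=
  isSmooth_iff.2 fun c => ((hg'.contDiffOn_log_det c).sub (hg.contDiffOn_log_det c)).congr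
    fun _ hz => inChart_logVolumeRatio hg hg' c hz

theorem ddbar_add {u v : X → ℝ} (hu : IsSmooth n u) (hv : IsSmooth n v) (c : atlas (Cn n) X)
    {z : Cn n} (hz : z ∈ c.1.target) :
    ddbar (fun x => u x + v x) c z = ddbar u c z + ddbar v c z :=
  levi_add ((hu.contDiffAt c hz).of_le ENat.LEInfty.out)
    ((hv.contDiffAt c hz).of_le ENat.LEInfty.out)

theorem ddbar_sub {u v : X → ℝ} (hu : IsSmooth n u) (hv : IsSmooth n v) (c : atlas (Cn n) X)
    {z : Cn n} (hz : z ∈ c.1.target) :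
    ddbar (fun x => u x - v x) c z = ddbar u c z - ddbar v c z := by
  have h := ddbar_add (hu.sub hv) hv c hz
  simp only [sub_add_cancel] at h
  rw [h, add_sub_cancel_right]

end Charts

/-! ### Integration of top-degree forms -/

/-! ### Divergence theorem and Leibniz rule on ℂⁿ -/

section Local

variable {n : ℕ}

/-- Integration by parts against the constant function 1. -/
theorem integral_fderiv_apply_eq_zero {F : Cn n → ℂ} (hF : ContDiff ℝ 1 F)
    (hc : HasCompactSupport F) (v : Cn n) : ∫ z, fderiv ℝ F z v = 0 := by
  have h1 : Integrable fun z => fderiv ℝ F z v :=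
    ((hF.continuous_fderiv (by norm_num)).clm_apply continuous_const).integrable_of_hasCompactSupport
      (hc.fderiv_apply ℝ v)
  have h := integral_mul_fderiv_eq_neg_fderiv_mul_of_integrable (μ := (volume : Measure (Cn n)))
    (f := fun _ => (1 : ℂ)) (g := F) (v := v) (by simp) (by simpa using h1)
    (by simpa using hF.continuous.integrable_of_hasCompactSupport hc)
    (fun _ _ => differentiableAt_const _) (fun _ _ => hF.differentiable (by norm_num) _)
  simpa using h

/-- The divergence theorem for functions supported in a compact subset of an open set. -/
theorem integrableOn_dz_and_integral_eq_zero {U K : Set (Cn n)} (hU : IsOpen U)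
    (hK : IsCompact K) (hKU : K ⊆ U) {F : Cn n → ℂ} (hF : ContDiffOn ℝ 1 F U)
    (h0 : ∀ z ∈ U, z ∉ K → F z = 0) (j : Fin n) :
    IntegrableOn (dz j F) U ∧ ∫ z in U, dz j F z = 0 := by
  -- The extension by zero is C¹ on the whole space, because U and the complement of K cover it.
  set G : Cn n → ℂ := U.indicator F with hG
  have hGU : ∀ z ∈ U, G =ᶠ[nhds z] F := fun z hz => by
    filter_upwards [hU.mem_nhds hz] with w hw
    rw [hG, Set.indicator_of_mem hw]
  have hGK : ∀ z, z ∉ K → G z = 0 := fun z hz => by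
    by_cases h : z ∈ U
    · rw [hG, Set.indicator_of_mem h, h0 z h hz]
    · rw [hG, Set.indicator_of_notMem h]
  have hGK' : ∀ z, z ∉ K → G =ᶠ[nhds z] fun _ => 0 := fun z hz => by
    filter_upwards [hK.isClosed.isOpen_compl.mem_nhds hz] with w hw
    exact hGK w hw
  have hGs : ContDiff ℝ 1 G := contDiff_iff_contDiffAt.2 fun z => by
    by_cases h : z ∈ U
    · exact (hF.contDiffAt (hU.mem_nhds h)).congr_of_eventuallyEq (hGU z h)
    · exact contDiffAt_const.congr_of_eventuallyEq (hGK' z fun hz => h (hKU hz))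
  have hGc : HasCompactSupport G := HasCompactSupport.intro hK hGK
  have hi : ∀ v, Integrable fun z => fderiv ℝ G z v := fun v =>
    ((hGs.continuous_fderiv (by norm_num)).clm_apply
      continuous_const).integrable_of_hasCompactSupport (hGc.fderiv_apply ℝ v)
  have hdi : Integrable (dz j G) := ((hi _).sub ((hi _).const_mul _)).div_const 2
  have hd0 : ∫ z, dz j G z = 0 := by
    simp only [dz]
    rw [integral_div, integral_sub (hi _) ((hi _).const_mul _), integral_const_mul,
      integral_fderiv_apply_eq_zero hGs hGc, integral_fderiv_apply_eq_zero hGs hGc]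
    simp
  have heq : ∀ z ∈ U, dz j G z = dz j F z := fun z hz => dz_congr (hGU z hz) j
  refine ⟨hdi.integrableOn.congr_fun heq hU.measurableSet, ?_⟩
  rw [← setIntegral_congr_fun hU.measurableSet heq, ← hd0]
  refine setIntegral_eq_integral_of_forall_compl_eq_zero fun z hz => ?_
  rw [dz_congr (hGK' z fun h => hz (hKU h)), dz_const]

/-- The Leibniz rule `∂(f ∂̄u ∧ Ω) = f ∂∂̄u ∧ Ω + ∂f ∧ ∂̄u ∧ Ω` for a product `Ω` of closed
`(1,1)`-forms. -/
theorem sum_dz_eq {z : Cn n} {f u : Cn n → ℝ} (hf : DifferentiableAt ℝ f z)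
    (hu : ContDiffAt ℝ 2 u z) {A : Fin n → Cn n → Matrix (Fin n) (Fin n) ℂ} (i : Fin n)
    (hA : ∀ m, m ≠ i → ∀ j k, DifferentiableAt ℝ (fun w => A m w j k) z)
    (hc : ∀ m, m ≠ i → ∀ j k l,
      dz l (fun w => A m w j k) z = dz j (fun w => A m w l k) z) :
    ∑ σ : Equiv.Perm (Fin n), ∑ τ : Equiv.Perm (Fin n),
      ((Equiv.Perm.sign σ : ℤ) : ℂ) * ((Equiv.Perm.sign τ : ℤ) : ℂ) *
        dz (σ i) (fun w => (f w : ℂ) * dzbar (τ i) (fun x => (u x : ℂ)) w *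
          ∏ m ∈ Finset.univ.erase i, A m w (σ m) (τ m)) z =
    f z * mixedDet (Function.update (fun m => A m z) i (levi u z)) +
      mixedDet (Function.update (fun m => A m z) i (gradMatrix f u z)) := by
  have hf' : DifferentiableAt ℝ (fun w => (f w : ℂ)) z :=
    Complex.ofRealCLM.differentiableAt.comp z hf
  have hu' := contDiffAt_ofReal hu
  have hd : ∀ k, DifferentiableAt ℝ (dzbar k fun w => (u w : ℂ)) z := fun k =>
    (ContDiffAt.dzbar (m := 1) (by simpa [one_add_one_eq_two] using hu') k).differentiableAt
      (by norm_num)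
  have hprod : ∀ σ τ : Equiv.Perm (Fin n), DifferentiableAt ℝ
      (fun w => ∏ m ∈ Finset.univ.erase i, A m w (σ m) (τ m)) z := fun σ τ =>
    (HasFDerivAt.finsetProd fun m hm =>
      (hA m (Finset.ne_of_mem_erase hm) (σ m) (τ m)).hasFDerivAt).differentiableAt
  have key : ∀ σ τ : Equiv.Perm (Fin n),
      dz (σ i) (fun w => (f w : ℂ) * dzbar (τ i) (fun x => (u x : ℂ)) w *
          ∏ m ∈ Finset.univ.erase i, A m w (σ m) (τ m)) z =
        f z * (levi u z (σ i) (τ i) * ∏ m ∈ Finset.univ.erase i, A m z (σ m) (τ m)) +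
        gradMatrix f u z (σ i) (τ i) * ∏ m ∈ Finset.univ.erase i, A m z (σ m) (τ m) +
        f z * dzbar (τ i) (fun x => (u x : ℂ)) z * ∑ m ∈ Finset.univ.erase i,
          dz (σ i) (fun w => A m w (σ m) (τ m)) z *
            ∏ l ∈ (Finset.univ.erase i).erase m, A l z (σ l) (τ l) := fun σ τ => by
    rw [dz_mul (hf'.fun_mul (hd _)) (hprod σ τ), dz_mul hf' (hd _),
      dz_prod _ fun m hm => hA m (Finset.ne_of_mem_erase hm) (σ m) (τ m)]
    simp only [levi, gradMatrix, Matrix.of_apply]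
    ring
  -- Closedness makes the derivative symmetric in σ(i) and σ(m), while composing σ with the
  -- transposition of i and m flips its sign: the terms cancel in pairs.
  have hcancel : ∀ τ : Equiv.Perm (Fin n), ∀ m ∈ Finset.univ.erase i,
      ∑ σ : Equiv.Perm (Fin n), ((Equiv.Perm.sign σ : ℤ) : ℂ) *
        (dz (σ i) (fun w => A m w (σ m) (τ m)) z *
          ∏ l ∈ (Finset.univ.erase i).erase m, A l z (σ l) (τ l)) = 0 := fun τ m hm => by
    have hmi : m ≠ i := Finset.ne_of_mem_erase hm
    refine Finset.sum_involution (fun σ _ => σ * Equiv.swap i m) (fun σ _ => ?_)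
      (fun σ _ _ h => ?_) (fun σ _ => Finset.mem_univ _) (fun σ _ => ?_)
    · have hp : ∏ l ∈ (Finset.univ.erase i).erase m, A l z ((σ * Equiv.swap i m) l) (τ l) =
          ∏ l ∈ (Finset.univ.erase i).erase m, A l z (σ l) (τ l) :=
        Finset.prod_congr rfl fun l hl => by
          rw [Equiv.Perm.mul_apply, Equiv.swap_apply_of_ne_of_ne
            (Finset.ne_of_mem_erase (Finset.mem_of_mem_erase hl)) (Finset.ne_of_mem_erase hl)]
      rw [hp, Equiv.Perm.sign_mul, Equiv.Perm.sign_swap hmi.symm, Equiv.Perm.mul_apply,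
        Equiv.Perm.mul_apply, Equiv.swap_apply_left, Equiv.swap_apply_right,
        hc m hmi (σ i) (τ m) (σ m)]
      push_cast
      ring
    · exact hmi (Equiv.swap_eq_one_iff.1 (mul_eq_left.1 h)).symm
    · simp [mul_assoc]
  simp only [key, mul_add, Finset.sum_add_distrib]
  have hzero : ∑ σ : Equiv.Perm (Fin n), ∑ τ : Equiv.Perm (Fin n),
      ((Equiv.Perm.sign σ : ℤ) : ℂ) * ((Equiv.Perm.sign τ : ℤ) : ℂ) *
        (f z * dzbar (τ i) (fun x => (u x : ℂ)) z * ∑ m ∈ Finset.univ.erase i,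
          dz (σ i) (fun w => A m w (σ m) (τ m)) z *
            ∏ l ∈ (Finset.univ.erase i).erase m, A l z (σ l) (τ l)) = 0 := by
    rw [Finset.sum_comm]
    refine Finset.sum_eq_zero fun τ _ => ?_
    calc _ = ((Equiv.Perm.sign τ : ℤ) : ℂ) * (f z * dzbar (τ i) (fun x => (u x : ℂ)) z) *
        ∑ m ∈ Finset.univ.erase i, ∑ σ : Equiv.Perm (Fin n), ((Equiv.Perm.sign σ : ℤ) : ℂ) *
        (dz (σ i) (fun w => A m w (σ m) (τ m)) z *
          ∏ l ∈ (Finset.univ.erase i).erase m, A l z (σ l) (τ l)) := by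
          rw [Finset.sum_comm, Finset.mul_sum]
          refine Finset.sum_congr rfl fun σ _ => ?_
          rw [← Finset.mul_sum]
          ring
      _ = 0 := by rw [Finset.sum_eq_zero (hcancel τ), mul_zero]
  rw [hzero, add_zero, mixedDet_update, mixedDet_update, Finset.mul_sum]
  congr 1
  refine Finset.sum_congr rfl fun σ _ => ?_
  rw [Finset.mul_sum]
  exact Finset.sum_congr rfl fun τ _ => by ring

end Local

/-! ### Top-degree forms on X and independence of charts -/

section Global

variable {n : ℕ} {X : Type*} [TopologicalSpace X] [ChartedSpace (Cn n) X]

/-- `η` is a continuous form of top degree. -/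
structure IsTopForm (η : TopCoeffs n X) : Prop where
  transform : ∀ (c c' : atlas (Cn n) X) (x : X), x ∈ c.1.source → x ∈ c'.1.source →
    η c (c.1 x) = Complex.normSq (jacobian c c' x).det * η c' (c'.1 x)
  continuousOn : ∀ c : atlas (Cn n) X, ContinuousOn (η c) c.1.target

theorem continuousOn_inChart {f : X → ℝ} (hf : Continuous f) (c : atlas (Cn n) X) :
    ContinuousOn (inChart f c) c.1.target :=
  hf.comp_continuousOn c.1.continuousOn_symm

theorem isTopForm_mul_wedge {f : X → ℝ} (hf : Continuous f) {A : Fin n → Coeffs n X}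
    (hA : ∀ m, IsContinuousForm (A m)) :
    IsTopForm fun c z => inChart f c z * wedge fun m => A m c z where
  transform c c' x hx hx' := by
    have h : (fun m => A m c (c.1 x)) = fun m =>
        (jacobian c c' x)ᵀ * A m c' (c'.1 x) * (jacobian c c' x).map (starRingEnd ℂ) :=
      funext fun m => (hA m).transform c c' x hx hx'
    simp only [inChart, c.1.left_inv hx, c'.1.left_inv hx']
    rw [h, wedge_transform]
    ring
  continuousOn c := by
    refine (continuousOn_inChart hf c).mul (continuousOn_const.mul
      (Complex.continuous_re.comp_continuousOn ?_))
    exact continuousOn_finsetSum _ fun σ _ => continuousOn_finsetSum _ fun τ _ =>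
      continuousOn_const.mul (continuousOn_finsetProd _ fun m _ => (hA m).continuousOn c _ _)

theorem IsTopForm.add {η ζ : TopCoeffs n X} (hη : IsTopForm η) (hζ : IsTopForm ζ) :
    IsTopForm fun c z => η c z + ζ c z where
  transform c c' x hx hx' := by
    rw [hη.transform c c' x hx hx', hζ.transform c c' x hx hx', mul_add]
  continuousOn c := (hη.continuousOn c).add (hζ.continuousOn c)

theorem integrableOn_of_zero_off_compact (c : atlas (Cn n) X) {K : Set X} (hK : IsCompact K)
    (hKc : K ⊆ c.1.source) {F : Cn n → ℝ} (hF : ContinuousOn F c.1.target)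
    (h0 : ∀ z ∈ c.1.target, c.1.symm z ∉ K → F z = 0) : IntegrableOn F c.1.target := by
  have hK' : IsCompact (c.1 '' K) := hK.image_of_continuousOn (c.1.continuousOn.mono hKc)
  have hsub : c.1 '' K ⊆ c.1.target := by
    rintro _ ⟨x, hx, rfl⟩
    exact c.1.map_source (hKc hx)
  refine IntegrableOn.of_forall_sdiff_eq_zero ((hF.mono hsub).integrableOn_compact hK')
    c.1.open_target.measurableSet fun z hz => h0 z hz.1 fun h => hz.2 ⟨_, h, c.1.right_inv hz.1⟩

/-- The real determinant of a complex-linear map is the norm from ℂ to ℝ of its complex determinant.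
-/
theorem abs_det_restrictScalars (L : Cn n →L[ℂ] Cn n) :
    |(L.restrictScalars ℝ).det| =
      Complex.normSq (LinearMap.toMatrix' (L : Cn n →ₗ[ℂ] Cn n)).det := by
  have h : (L.restrictScalars ℝ).det = Algebra.norm ℝ (LinearMap.det (L : Cn n →ₗ[ℂ] Cn n)) :=
    LinearMap.det_restrictScalars (f := (L : Cn n →ₗ[ℂ] Cn n))
  rw [h, Algebra.norm_complex_apply, abs_of_nonneg (Complex.normSq_nonneg _),
    LinearMap.det_toMatrix']

/-- The change of variables formula between two charts. -/
theorem setIntegral_chart_eq [IsManifold 𝓘(ℂ, Cn n) ω X] {η : TopCoeffs n X}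
    (hη : IsTopForm η) (c c' : atlas (Cn n) X) {ρ : X → ℝ} (hρ : ∀ x ∉ c.1.source, ρ x = 0)
    (h0 : ∀ z ∈ c.1.target, c.1.symm z ∉ c'.1.source → η c z = 0) :
    ∫ z in c.1.target, ρ (c.1.symm z) * η c z =
      ∫ w in c'.1.target, ρ (c'.1.symm w) * η c' w := by
  set s : Set (Cn n) := c.1.target ∩ c.1.symm ⁻¹' c'.1.source with hs
  set F : Cn n → Cn n := fun z => c'.1 (c.1.symm z) with hF
  have hso : IsOpen s := c.1.symm.isOpen_inter_preimage c'.1.open_source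
  have himage : F '' s = c'.1.target ∩ c'.1.symm ⁻¹' c.1.source := by
    ext w
    constructor
    · rintro ⟨z, ⟨hz, hz'⟩, rfl⟩
      refine ⟨c'.1.map_source hz', ?_⟩
      simpa [hF, c'.1.left_inv hz'] using c.1.map_target hz
    · rintro ⟨hw, hw'⟩
      refine ⟨c.1 (c'.1.symm w), ⟨c.1.map_source hw', ?_⟩, ?_⟩
      · simpa [c.1.left_inv hw'] using c'.1.map_target hw
      · simp [hF, c.1.left_inv hw', c'.1.right_inv hw]
  have hinj : Set.InjOn F s := by
    rintro z ⟨hz, hz'⟩ w ⟨hw, hw'⟩ h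
    exact c.1.symm.injOn hz hw (c'.1.injOn hz' hw' h)
  have hderiv : ∀ z ∈ s, HasFDerivWithinAt F ((fderiv ℂ F z).restrictScalars ℝ) s z :=
    fun z hz => by
      have h := contDiffAt_transition c c' (c.1.map_target hz.1) hz.2
      rw [c.1.right_inv hz.1] at h
      exact ((h.differentiableAt (by simp)).hasFDerivAt.restrictScalars ℝ).hasFDerivWithinAt
  -- Off the overlap the left integrand vanishes because of η, the right one because of ρ. Both
  -- integrals thus live on `s` and its image.
  have h1 : ∫ z in c.1.target, ρ (c.1.symm z) * η c z = ∫ z in s, ρ (c.1.symm z) * η c z := by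
    refine setIntegral_eq_of_subset_of_forall_sdiff_eq_zero c.1.open_target.measurableSet
      Set.inter_subset_left fun z hz => ?_
    rw [h0 z hz.1 fun h => hz.2 ⟨hz.1, h⟩, mul_zero]
  have h2 : ∫ w in c'.1.target, ρ (c'.1.symm w) * η c' w =
      ∫ w in F '' s, ρ (c'.1.symm w) * η c' w := by
    rw [himage]
    refine setIntegral_eq_of_subset_of_forall_sdiff_eq_zero c'.1.open_target.measurableSet
      Set.inter_subset_left fun w hw => ?_
    rw [hρ _ fun h => hw.2 ⟨hw.1, h⟩, zero_mul]
  rw [h1, h2, integral_image_eq_integral_abs_det_fderiv_smul _ hso.measurableSet hderiv hinj]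
  refine setIntegral_congr_fun hso.measurableSet fun z hz => ?_
  have ht := hη.transform c c' (c.1.symm z) (c.1.map_target hz.1) hz.2
  rw [c.1.right_inv hz.1, jacobian, c.1.right_inv hz.1] at ht
  simp only [smul_eq_mul]
  rw [abs_det_restrictScalars, ht]
  simp only [hF, c'.1.left_inv hz.2]
  ring

variable [T2Space X] [CompactSpace X]

variable (n X) in
/-- The finitely many charts which meet the support of `chartPartition`. -/
def chartSupport : Finset (atlas (Cn n) X) :=
  ((chartPartition n X).locallyFinite.finite_nonempty_of_compact).toFinset

theorem chartPartition_eq_zero {c : atlas (Cn n) X} (hc : c ∉ chartSupport n X) (x : X) :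
    chartPartition n X c x = 0 := by
  by_contra h
  exact hc ((Set.Finite.mem_toFinset _).2 ⟨x, h⟩)

theorem chartPartition_tsupport_subset (c : atlas (Cn n) X) :
    tsupport (chartPartition n X c) ⊆ c.1.source :=
  (exists_chartPartition n X).choose_spec c

theorem sum_chartPartition (x : X) : ∑ c ∈ chartSupport n X, chartPartition n X c x = 1 := by
  rw [← (chartPartition n X).sum_eq_one (Set.mem_univ x)]
  refine (finsum_eq_sum_of_support_subset _ fun c hc => ?_).symm
  by_contra h
  exact hc (chartPartition_eq_zero h x)

theorem integral_eq_sum (η : TopCoeffs n X) :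
    integral η = ∑ c ∈ chartSupport n X,
      ∫ z in c.1.target, chartPartition n X c (c.1.symm z) * η c z := by
  refine finsum_eq_sum_of_support_subset _ fun c hc => ?_
  by_contra h
  refine hc ?_
  simp [chartPartition_eq_zero h]

theorem integral_congr {η ζ : TopCoeffs n X}
    (h : ∀ c : atlas (Cn n) X, ∀ z ∈ c.1.target, η c z = ζ c z) : integral η = integral ζ := by
  rw [integral_eq_sum, integral_eq_sum]
  refine Finset.sum_congr rfl fun c _ =>
    setIntegral_congr_fun c.1.open_target.measurableSet fun z hz => ?_
  simp only [h c z hz]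

theorem integrableOn_chartPartition_mul {η : TopCoeffs n X} (hη : IsTopForm η)
    (c : atlas (Cn n) X) :
    IntegrableOn (fun z => chartPartition n X c (c.1.symm z) * η c z) c.1.target := by
  refine integrableOn_of_zero_off_compact c (isClosed_tsupport _).isCompact
    (chartPartition_tsupport_subset c)
    ((continuousOn_inChart (chartPartition n X c).continuous c).mul (hη.continuousOn c))
    fun z _ h => ?_
  rw [image_eq_zero_of_notMem_tsupport h, zero_mul]

theorem integral_add {η ζ : TopCoeffs n X} (hη : IsTopForm η) (hζ : IsTopForm ζ) :
    (integral fun c z => η c z + ζ c z) = integral η + integral ζ := by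
  rw [integral_eq_sum, integral_eq_sum, integral_eq_sum, ← Finset.sum_add_distrib]
  refine Finset.sum_congr rfl fun c _ => ?_
  simp only [mul_add]
  exact MeasureTheory.integral_add (integrableOn_chartPartition_mul hη c)
    (integrableOn_chartPartition_mul hζ c)

theorem integral_sub {η ζ : TopCoeffs n X} (hη : IsTopForm η) (hζ : IsTopForm ζ) :
    (integral fun c z => η c z - ζ c z) = integral η - integral ζ := by
  rw [integral_eq_sum, integral_eq_sum, integral_eq_sum, ← Finset.sum_sub_distrib]
  refine Finset.sum_congr rfl fun c _ => ?_
  simp only [mul_sub]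
  exact MeasureTheory.integral_sub (integrableOn_chartPartition_mul hη c)
    (integrableOn_chartPartition_mul hζ c)

theorem integral_nonneg {η : TopCoeffs n X}
    (h : ∀ c : atlas (Cn n) X, ∀ z ∈ c.1.target, 0 ≤ η c z) : 0 ≤ integral η := by
  rw [integral_eq_sum]
  exact Finset.sum_nonneg fun c _ => setIntegral_nonneg c.1.open_target.measurableSet
    fun z hz => mul_nonneg ((chartPartition n X).nonneg c _) (h c z hz)

/-- The integral of a form supported in the domain of a chart can be computed in this chart. -/
theorem integral_eq_setIntegral [IsManifold 𝓘(ℂ, Cn n) ω X] {η : TopCoeffs n X}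
    (hη : IsTopForm η) (c : atlas (Cn n) X) {K : Set X} (hK : IsCompact K)
    (hKc : K ⊆ c.1.source)
    (h0 : ∀ c' : atlas (Cn n) X, ∀ z ∈ c'.1.target, c'.1.symm z ∉ K → η c' z = 0) :
    integral η = ∫ z in c.1.target, η c z := by
  rw [integral_eq_sum]
  -- Each piece ρ_{c'} η is carried from c' to the single chart c, where the ρ_{c'} sum to 1.
  calc _ = ∑ c' ∈ chartSupport n X,
      ∫ z in c.1.target, chartPartition n X c' (c.1.symm z) * η c z :=
        Finset.sum_congr rfl fun c' _ => setIntegral_chart_eq hη c' c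
          (fun x hx => image_eq_zero_of_notMem_tsupport fun h =>
            hx (chartPartition_tsupport_subset c' h))
          (fun z hz h => h0 c' z hz fun h' => h (hKc h'))
    _ = ∫ z in c.1.target, ∑ c' ∈ chartSupport n X,
        chartPartition n X c' (c.1.symm z) * η c z :=
        (integral_finsetSum _ fun c' _ => integrableOn_of_zero_off_compact c hK hKc
          ((continuousOn_inChart (chartPartition n X c').continuous c).mul (hη.continuousOn c))
          fun z hz h => by
            rw [Pi.mul_apply, h0 c z hz h, mul_zero]).symm
    _ = _ := by simp only [← Finset.sum_mul, sum_chartPartition, one_mul]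

end Global

/-! ### Pairing functions with products of `(1,1)`-forms -/

section Pairing

variable {n : ℕ} {X : Type*} [TopologicalSpace X] [ChartedSpace (Cn n) X]

theorem update_apply_chart (A : Fin n → Coeffs n X) (i : Fin n) (M : Coeffs n X)
    (c : atlas (Cn n) X) (z : Cn n) :
    (fun m => Function.update A i M m c z) = Function.update (fun m => A m c z) i (M c z) := by
  funext m
  by_cases h : m = i
  · subst h
    simp
  · simp [Function.update_of_ne h]

theorem isContinuousForm_update {A : Fin n → Coeffs n X} (hA : ∀ m, IsContinuousForm (A m))
    (i : Fin n) {M : Coeffs n X} (hM : IsContinuousForm M) (m : Fin n) :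
    IsContinuousForm (Function.update A i M m) := by
  by_cases h : m = i
  · subst h
    simpa using hM
  · simpa [Function.update_of_ne h] using hA m

variable [T2Space X] [CompactSpace X]

/-- The integral over `X` of `f` times the product of the `(1,1)`-forms `A m`. -/
def pairing (f : X → ℝ) (A : Fin n → Coeffs n X) : ℝ :=
  integral fun c z => inChart f c z * wedge fun m => A m c z

theorem pairing_congr {f : X → ℝ} {A B : Fin n → Coeffs n X}
    (h : ∀ m, ∀ c : atlas (Cn n) X, ∀ z ∈ c.1.target, A m c z = B m c z) :
    pairing f A = pairing f B :=
  integral_congr fun c z hz => by simp only [h _ c z hz]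

theorem pairing_add_left {f f' : X → ℝ} (hf : Continuous f) (hf' : Continuous f')
    {A : Fin n → Coeffs n X} (hA : ∀ m, IsContinuousForm (A m)) :
    pairing (fun x => f x + f' x) A = pairing f A + pairing f' A := by
  rw [pairing, pairing, pairing, ← integral_add (isTopForm_mul_wedge hf hA)
    (isTopForm_mul_wedge hf' hA)]
  exact integral_congr fun c z _ => by simp only [inChart]; ring

theorem pairing_update_add {f : X → ℝ} (hf : Continuous f) {A : Fin n → Coeffs n X}
    (hA : ∀ m, IsContinuousForm (A m)) (i : Fin n) {L M N : Coeffs n X}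
    (hM : IsContinuousForm M) (hN : IsContinuousForm N)
    (h : ∀ c : atlas (Cn n) X, ∀ z ∈ c.1.target, L c z = M c z + N c z) :
    pairing f (Function.update A i L) =
      pairing f (Function.update A i M) + pairing f (Function.update A i N) := by
  rw [pairing, pairing, pairing,
    ← integral_add (isTopForm_mul_wedge hf (isContinuousForm_update hA i hM))
      (isTopForm_mul_wedge hf (isContinuousForm_update hA i hN))]
  refine integral_congr fun c z hz => ?_
  simp only [update_apply_chart, h c z hz, wedge_update_add, mul_add]

theorem pairing_update_sub {f : X → ℝ} (hf : Continuous f) {A : Fin n → Coeffs n X}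
    (hA : ∀ m, IsContinuousForm (A m)) (i : Fin n) {L M N : Coeffs n X}
    (hM : IsContinuousForm M) (hN : IsContinuousForm N)
    (h : ∀ c : atlas (Cn n) X, ∀ z ∈ c.1.target, L c z = M c z - N c z) :
    pairing f (Function.update A i L) =
      pairing f (Function.update A i M) - pairing f (Function.update A i N) := by
  rw [pairing, pairing, pairing,
    ← integral_sub (isTopForm_mul_wedge hf (isContinuousForm_update hA i hM))
      (isTopForm_mul_wedge hf (isContinuousForm_update hA i hN))]
  refine integral_congr fun c z hz => ?_
  simp only [update_apply_chart, h c z hz, wedge_update_sub, mul_sub]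

theorem pairing_update_swap (f : X → ℝ) {A : Fin n → Coeffs n X} {i j : Fin n}
    (h : A i = A j) (M : Coeffs n X) :
    pairing f (Function.update A i M) = pairing f (Function.update A j M) := by
  refine integral_congr fun c z _ => ?_
  simp only [update_apply_chart]
  rw [wedge_update_swap (fun m => A m c z) (i := i) (j := j) (by simp only [h])]

end Pairing

/-! ### Stokes' theorem -/

section Stokes

variable {n : ℕ} {X : Type*} [TopologicalSpace X] [ChartedSpace (Cn n) X]

/-- The density of `i∂(f ∂̄u ∧ Ω)`, where `Ω` is the product of the forms `A m`, `m ≠ i`. -/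
def stokesDensity (f u : X → ℝ) (A : Fin n → Coeffs n X) (i : Fin n) : TopCoeffs n X :=
  fun c z => inChart f c z * wedge (fun m => Function.update A i (ddbar u) m c z) +
    inChart (fun _ => 1) c z * wedge (fun m => Function.update A i (gradForm f u) m c z)

theorem dz_inChart_eq_zero {f : X → ℝ} (c : atlas (Cn n) X) {z : Cn n} (hz : z ∈ c.1.target)
    (h : c.1.symm z ∉ tsupport f) (j : Fin n) :
    dz j (fun w => (inChart f c w : ℂ)) z = 0 := by
  have h1 : ∀ᶠ w in nhds z, c.1.symm w ∉ tsupport f :=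
    (c.1.symm.continuousAt hz).eventually
      ((isClosed_tsupport f).isOpen_compl.mem_nhds h)
  rw [dz_congr (g := fun _ => 0) ?_ j, dz_const]
  filter_upwards [h1] with w hw
  simp [inChart, image_eq_zero_of_notMem_tsupport hw]

variable [IsManifold 𝓘(ℂ, Cn n) ω X]

theorem isTopForm_stokesDensity {f u : X → ℝ} (hf : IsSmooth n f) (hu : IsSmooth n u)
    {A : Fin n → Coeffs n X} (hA : ∀ m, IsClosedForm (A m)) (i : Fin n) :
    IsTopForm (stokesDensity f u A i) :=
  (isTopForm_mul_wedge hf.continuous (isContinuousForm_update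
    (fun m => (hA m).isContinuousForm) i (isClosedForm_ddbar hu).isContinuousForm)).add
  (isTopForm_mul_wedge continuous_const (isContinuousForm_update
    (fun m => (hA m).isContinuousForm) i (isContinuousForm_gradForm hf hu)))

theorem stokesDensity_eq {f u : X → ℝ} (hf : IsSmooth n f) (hu : IsSmooth n u)
    {A : Fin n → Coeffs n X} (hA : ∀ m, IsClosedForm (A m)) (i : Fin n) (c : atlas (Cn n) X)
    {z : Cn n} (hz : z ∈ c.1.target) :
    stokesDensity f u A i c z = 2 ^ n *
      (∑ σ : Equiv.Perm (Fin n), ∑ τ : Equiv.Perm (Fin n),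
      ((Equiv.Perm.sign σ : ℤ) : ℂ) * ((Equiv.Perm.sign τ : ℤ) : ℂ) *
        dz (σ i) (fun w => (inChart f c w : ℂ) *
          dzbar (τ i) (fun x => (inChart u c x : ℂ)) w *
          ∏ m ∈ Finset.univ.erase i, A m c w (σ m) (τ m)) z).re := by
  have hn := c.1.open_target.mem_nhds hz
  rw [sum_dz_eq (A := fun m => A m c) ((hf.contDiffAt c hz).differentiableAt (by simp))
    ((hu.contDiffAt c hz).of_le ENat.LEInfty.out) i
    (fun m _ j k => (((hA m).smooth c j k).contDiffAt hn).differentiableAt (by simp))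
    (fun m _ j k l => (hA m).closed c z hz j k l), stokesDensity, update_apply_chart,
    update_apply_chart, wedge_eq_mixedDet, wedge_eq_mixedDet, Complex.add_re,
    Complex.re_ofReal_mul]
  simp only [inChart, ddbar, gradForm]
  ring

variable [T2Space X] [CompactSpace X]

/-- The integral can be computed in one chart, where the density is a signed sum of coordinate
derivatives of functions vanishing off a compact set. -/
theorem integral_stokesDensity_of_tsupport_subset {f u : X → ℝ} (hf : IsSmooth n f)
    (hu : IsSmooth n u) {A : Fin n → Coeffs n X} (hA : ∀ m, IsClosedForm (A m)) (i : Fin n)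
    (c : atlas (Cn n) X) (hfc : tsupport f ⊆ c.1.source) :
    integral (stokesDensity f u A i) = 0 := by
  have hK : IsCompact (tsupport f) := (isClosed_tsupport f).isCompact
  have hzero : ∀ c' : atlas (Cn n) X, ∀ z ∈ c'.1.target, c'.1.symm z ∉ tsupport f →
      stokesDensity f u A i c' z = 0 := fun c' z hz h => by
    have hg : gradForm f u c' z = 0 := by
      ext j k
      simp [gradForm, gradMatrix, dz_inChart_eq_zero c' hz h]
    have h2 : wedge (fun m => Function.update A i (gradForm f u) m c' z) = 0 := by
      rw [update_apply_chart, hg, wedge_eq_mixedDet, mixedDet_update]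
      simp
    rw [stokesDensity, h2, inChart, image_eq_zero_of_notMem_tsupport h]
    simp
  rw [integral_eq_setIntegral (isTopForm_stokesDensity hf hu hA i) c hK hfc hzero,
    setIntegral_congr_fun c.1.open_target.measurableSet
      fun z hz => stokesDensity_eq hf hu hA i c hz]
  have hK' : IsCompact (c.1 '' tsupport f) :=
    hK.image_of_continuousOn (c.1.continuousOn.mono hfc)
  have hsub : c.1 '' tsupport f ⊆ c.1.target := by
    rintro _ ⟨x, hx, rfl⟩
    exact c.1.map_source (hfc hx)
  have hdiv := fun σ τ : Equiv.Perm (Fin n) =>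
    integrableOn_dz_and_integral_eq_zero c.1.open_target hK' hsub
    (F := fun w => (inChart f c w : ℂ) * dzbar (τ i) (fun x => (inChart u c x : ℂ)) w *
          ∏ m ∈ Finset.univ.erase i, A m c w (σ m) (τ m))
    (fun z hz => by
      have h1 : ContDiffAt ℝ 1 (fun w => (inChart f c w : ℂ)) z :=
        (contDiffAt_ofReal (hf.contDiffAt c hz)).of_le ENat.LEInfty.out
      have h2 : ContDiffAt ℝ 1 (dzbar (τ i) fun w => (inChart u c w : ℂ)) z :=
        ContDiffAt.dzbar ((contDiffAt_ofReal (hu.contDiffAt c hz)).of_le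
          (by rw [one_add_one_eq_two]; exact ENat.LEInfty.out)) _
      have h3 : ContDiffWithinAt ℝ 1
          (fun w => ∏ m ∈ Finset.univ.erase i, A m c w (σ m) (τ m)) c.1.target z :=
        contDiffWithinAt_prod fun m _ =>
          ((hA m).smooth c (σ m) (τ m) z hz).of_le ENat.LEInfty.out
      exact (h1.mul h2).contDiffWithinAt.mul h3)
    (fun z hz h => by
      have : c.1.symm z ∉ tsupport f := fun h' => h ⟨_, h', c.1.right_inv hz⟩
      simp [inChart, image_eq_zero_of_notMem_tsupport this]) (σ i)
  rw [integral_const_mul]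
  have hint : ∀ σ : Equiv.Perm (Fin n), ∀ τ : Equiv.Perm (Fin n), Integrable (fun z =>
      ((Equiv.Perm.sign σ : ℤ) : ℂ) * ((Equiv.Perm.sign τ : ℤ) : ℂ) *
        dz (σ i) (fun w => (inChart f c w : ℂ) *
          dzbar (τ i) (fun x => (inChart u c x : ℂ)) w *
          ∏ m ∈ Finset.univ.erase i, A m c w (σ m) (τ m)) z)
      (volume.restrict c.1.target) := fun σ τ => (hdiv σ τ).1.const_mul _
  have hre := integral_re (𝕜 := ℂ) (integrable_finsetSum Finset.univ fun σ _ =>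
    integrable_finsetSum Finset.univ fun τ _ => hint σ τ)
  simp only [RCLike.re_to_complex] at hre
  rw [hre, integral_finsetSum _ fun σ _ => integrable_finsetSum _ fun τ _ => hint σ τ,
    Finset.sum_eq_zero fun σ _ => ?_]
  · simp
  · rw [integral_finsetSum _ fun τ _ => hint σ τ]
    refine Finset.sum_eq_zero fun τ _ => ?_
    rw [integral_const_mul, (hdiv σ τ).2, mul_zero]

theorem integral_stokesDensity_add {f f' u : X → ℝ} (hf : IsSmooth n f) (hf' : IsSmooth n f')
    (hu : IsSmooth n u) {A : Fin n → Coeffs n X} (hA : ∀ m, IsClosedForm (A m)) (i : Fin n) :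
    integral (stokesDensity (fun x => f x + f' x) u A i) =
      integral (stokesDensity f u A i) + integral (stokesDensity f' u A i) := by
  rw [← integral_add (isTopForm_stokesDensity hf hu hA i) (isTopForm_stokesDensity hf' hu hA i)]
  refine integral_congr fun c z hz => ?_
  have hd : ∀ {f : X → ℝ}, IsSmooth n f →
      DifferentiableAt ℝ (fun w => (inChart f c w : ℂ)) z := fun hf =>
    (contDiffAt_ofReal (hf.contDiffAt c hz)).differentiableAt (by simp)
  have hg : gradForm (fun x => f x + f' x) u c z = gradForm f u c z + gradForm f' u c z := by
    ext j k
    have h := dz_add (hd hf) (hd hf') j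
    simp only [gradForm, gradMatrix, Matrix.of_apply, Matrix.add_apply, ← add_mul, ← h]
    simp [inChart]
  simp only [stokesDensity, update_apply_chart, hg, wedge_update_add]
  simp only [inChart]
  ring

/-- The density is additive in f, so f may be cut into pieces supported in charts. The pieces must
be differentiable, so a smooth partition is used in place of the continuous `chartPartition`. -/
theorem integral_stokesDensity {f u : X → ℝ} (hf : IsSmooth n f) (hu : IsSmooth n u)
    {A : Fin n → Coeffs n X} (hA : ∀ m, IsClosedForm (A m)) (i : Fin n) :
    integral (stokesDensity f u A i) = 0 := by
  have := isManifold_real (n := n) (X := X)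
  obtain ⟨χ, hχ⟩ := SmoothPartitionOfUnity.exists_isSubordinate 𝓘(ℝ, Cn n)
    (isClosed_univ (X := X)) (fun c : atlas (Cn n) X => c.1.source) (fun c => c.1.open_source)
    fun x _ => Set.mem_iUnion.2
      ⟨⟨chartAt (Cn n) x, chart_mem_atlas (Cn n) x⟩, mem_chart_source (Cn n) x⟩
  have hsm : ∀ c, IsSmooth n fun x => χ c x * f x := fun c =>
    ContMDiff.mul (χ c).contMDiff hf
  have hfin := χ.locallyFinite.finite_nonempty_of_compact
  have hsum : f = fun x => ∑ c ∈ hfin.toFinset, χ c x * f x := by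
    funext x
    rw [← Finset.sum_mul, ← finsum_eq_sum_of_support_subset, χ.sum_eq_one (Set.mem_univ x),
      one_mul]
    intro c hc
    exact (Set.Finite.mem_toFinset _).2 ⟨x, hc⟩
  have key : ∀ s : Finset (atlas (Cn n) X),
      IsSmooth n (fun x => ∑ c ∈ s, χ c x * f x) ∧
        integral (stokesDensity (fun x => ∑ c ∈ s, χ c x * f x) u A i) = 0 := fun s => by
    induction s using Finset.cons_induction with
    | empty =>
      simp only [Finset.sum_empty]
      -- Additivity at 0 + 0 reads I = I + I, hence I = 0.
      have h := integral_stokesDensity_add (isSmooth_const (X := X) 0)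
        (isSmooth_const (X := X) 0) hu hA i
      simp only [add_zero] at h
      exact ⟨isSmooth_const 0, by linarith⟩
    | cons c s hc ih =>
      simp only [Finset.sum_cons]
      refine ⟨(hsm c).add ih.1, ?_⟩
      rw [integral_stokesDensity_add (hsm c) ih.1 hu hA, ih.2, add_zero]
      refine integral_stokesDensity_of_tsupport_subset (hsm c) hu hA i c ?_
      exact (closure_mono (Function.support_mul_subset_left _ _)).trans (hχ c)
  rw [hsum]
  exact (key _).2

/-- Integration by parts: `∫ f i∂∂̄u ∧ Ω = -∫ i∂f ∧ ∂̄u ∧ Ω`. -/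
theorem pairing_ddbar_eq_neg {f u : X → ℝ} (hf : IsSmooth n f) (hu : IsSmooth n u)
    {A : Fin n → Coeffs n X} (hA : ∀ m, IsClosedForm (A m)) (i : Fin n) :
    pairing f (Function.update A i (ddbar u)) =
      -pairing (fun _ => 1) (Function.update A i (gradForm f u)) := by
  have hA' : ∀ m, IsContinuousForm (A m) := fun m => (hA m).isContinuousForm
  rw [eq_neg_iff_add_eq_zero, ← integral_stokesDensity hf hu hA i, pairing, pairing]
  exact (integral_add (isTopForm_mul_wedge hf.continuous (isContinuousForm_update hA' i
      (isClosedForm_ddbar hu).isContinuousForm))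
    (isTopForm_mul_wedge continuous_const (isContinuousForm_update hA' i
      (isContinuousForm_gradForm hf hu)))).symm

/-- Both sides reduce to gradient pairings, which are exchanged by conjugate transposition; the
other factors are Hermitian and the wedge product is real. -/
theorem pairing_ddbar_comm {f u : X → ℝ} (hf : IsSmooth n f) (hu : IsSmooth n u)
    {A : Fin n → Coeffs n X} (hA : ∀ m, IsClosedForm (A m)) (i : Fin n) :
    pairing f (Function.update A i (ddbar u)) = pairing u (Function.update A i (ddbar f)) := by
  rw [pairing_ddbar_eq_neg hf hu hA, pairing_ddbar_eq_neg hu hf hA]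
  congr 1
  refine integral_congr fun c z hz => ?_
  congr 1
  rw [update_apply_chart, update_apply_chart, ← wedge_conjTranspose]
  congr 1
  funext m
  by_cases h : m = i
  · subst h
    simp only [Function.update_self]
    exact gradMatrix_conjTranspose ((hf.contDiffAt c hz).differentiableAt (by simp))
      ((hu.contDiffAt c hz).differentiableAt (by simp))
  · simp only [Function.update_of_ne h]
    exact (hA m).isHermitian c z hz

/-- By parts this is minus the Dirichlet energy of u, the integral of a wedge product of
semidefinite forms. -/
theorem pairing_ddbar_self_nonpos {u : X → ℝ} (hu : IsSmooth n u) {g : Coeffs n X}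
    (hg : IsKahler g) (i : Fin n) :
    pairing u (Function.update (fun _ => g) i (ddbar u)) ≤ 0 := by
  rw [pairing_ddbar_eq_neg hu hu (fun _ => hg.isClosedForm), neg_nonpos]
  refine integral_nonneg fun c z hz => ?_
  simp only [inChart, one_mul]
  refine wedge_nonneg fun m => ?_
  by_cases h : m = i
  · subst h
    simp only [Function.update_self]
    exact gradMatrix_posSemidef ((hu.contDiffAt c hz).differentiableAt (by simp))
  · simp only [Function.update_of_ne h]
    exact (hg.posDef c z hz).posSemidef

end Stokes

/-! ### The cocycle property of the Aubin–Mabuchi energy -/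

section Cocycle

/-- The telescoping identity behind the cocycle property. -/
theorem sum_telescope {F G : ℕ → ℕ → ℝ} (n : ℕ)
    (h : ∀ k p, k ≤ p → p < n → F k p - F k (p + 1) = G k (p + 1) - G (k + 1) (p + 1)) :
    ∑ k ∈ Finset.range (n + 1), (F k k + G k k) =
      ∑ k ∈ Finset.range (n + 1), F k n + ∑ k ∈ Finset.range (n + 1), G 0 k := by
  induction n with
  | zero => simp
  | succ n ih =>
    have ih := ih fun k p h1 h2 => h k p h1 (h2.trans n.lt_succ_self)
    -- Raising the second index of every F from n to n + 1 costs a sum of differences of G that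
    -- telescopes in k.
    have h1 : ∑ k ∈ Finset.range (n + 1), F k n - ∑ k ∈ Finset.range (n + 1), F k (n + 1) =
        G 0 (n + 1) - G (n + 1) (n + 1) := by
      rw [← Finset.sum_range_sub' (fun k => G k (n + 1)), ← Finset.sum_sub_distrib]
      exact Finset.sum_congr rfl fun k hk =>
        h k n (Nat.lt_succ_iff.1 (Finset.mem_range.1 hk)) n.lt_succ_self
    rw [Finset.sum_range_succ, ih, Finset.sum_range_succ (fun k => F k (n + 1)),
      Finset.sum_range_succ (fun k => G 0 k) (n + 1)]
    linarith

variable {n : ℕ} {X : Type*} [TopologicalSpace X] [ChartedSpace (Cn n) X]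

/-- The product `a ^ p b ^ (k - p) c ^ (n - k)` of `(1,1)`-forms. -/
def word (a b c : Coeffs n X) (p k : ℕ) : Fin n → Coeffs n X := fun m =>
  if m.val < p then a else if m.val < k then b else c

theorem word_isClosedForm {a b c : Coeffs n X} (ha : IsClosedForm a) (hb : IsClosedForm b)
    (hc : IsClosedForm c) (p k : ℕ) (m : Fin n) : IsClosedForm (word a b c p k m) := by
  unfold word
  split_ifs <;> assumption

theorem word_succ_right (a b c : Coeffs n X) {p k : ℕ} (hpk : p ≤ k) (hk : k < n) :
    word a b c p (k + 1) = Function.update (word a b c p k) ⟨k, hk⟩ b := by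
  funext m
  by_cases h : m = ⟨k, hk⟩
  · subst h
    simp [word, hpk]
  · have : m.val ≠ k := fun h' => h (Fin.ext h')
    rw [Function.update_of_ne h]
    simp only [word]
    split_ifs <;> first | rfl | omega

theorem word_update_right (a b c : Coeffs n X) {p k : ℕ} (hpk : p ≤ k) (hk : k < n) :
    Function.update (word a b c p k) ⟨k, hk⟩ c = word a b c p k := by
  rw [Function.update_eq_self_iff]
  simp [word, hpk]

theorem word_succ_left (a b c : Coeffs n X) {p k : ℕ} (hpk : p < k) (hp : p < n) :
    word a b c (p + 1) k = Function.update (word a b c p k) ⟨p, hp⟩ a := by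
  funext m
  by_cases h : m = ⟨p, hp⟩
  · subst h
    simp [word]
  · have : m.val ≠ p := fun h' => h (Fin.ext h')
    rw [Function.update_of_ne h]
    simp only [word]
    split_ifs <;> first | rfl | omega

theorem word_update_left (a b c : Coeffs n X) {p k : ℕ} (hpk : p < k) (hp : p < n) :
    Function.update (word a b c p k) ⟨p, hp⟩ b = word a b c p k := by
  rw [Function.update_eq_self_iff]
  simp [word, hpk]

variable [IsManifold 𝓘(ℂ, Cn n) ω X] [T2Space X] [CompactSpace X]

/-- The two words differ only in slot k, holding c in one and b in the other, and c − b = i∂∂̄φ. -/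
theorem pairing_word_sub_right {a b c : Coeffs n X} (ha : IsClosedForm a)
    (hb : IsClosedForm b) (hc : IsClosedForm c) {φ : X → ℝ} (hφ : IsSmooth n φ)
    (hbc : ∀ e : atlas (Cn n) X, ∀ z ∈ e.1.target, c e z = b e z + ddbar φ e z)
    {f : X → ℝ} (hf : Continuous f) {p k : ℕ} (hpk : p ≤ k) (hk : k < n) :
    pairing f (word a b c p k) - pairing f (word a b c p (k + 1)) =
      pairing f (Function.update (word a b c p k) ⟨k, hk⟩ (ddbar φ)) := by
  rw [word_succ_right a b c hpk hk, sub_eq_iff_eq_add', ← pairing_update_add hf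
    (fun m => (word_isClosedForm ha hb hc p k m).isContinuousForm) _ hb.isContinuousForm
    (isClosedForm_ddbar hφ).isContinuousForm hbc, word_update_right a b c hpk hk]

theorem pairing_word_sub_left {a b c : Coeffs n X} (ha : IsClosedForm a)
    (hb : IsClosedForm b) (hc : IsClosedForm c) {ψ : X → ℝ} (hψ : IsSmooth n ψ)
    (hab : ∀ e : atlas (Cn n) X, ∀ z ∈ e.1.target, b e z = a e z + ddbar ψ e z)
    {f : X → ℝ} (hf : Continuous f) {p k : ℕ} (hpk : p < k) (hp : p < n) :
    pairing f (word a b c p k) - pairing f (word a b c (p + 1) k) =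
      pairing f (Function.update (word a b c p k) ⟨p, hp⟩ (ddbar ψ)) := by
  rw [word_succ_left a b c hpk hp, sub_eq_iff_eq_add', ← pairing_update_add hf
    (fun m => (word_isClosedForm ha hb hc p k m).isContinuousForm) _ ha.isContinuousForm
    (isClosedForm_ddbar hψ).isContinuousForm hab, word_update_left a b c hpk hp]

/-- Up to normalisation, the energy of ψ + φ from a to c is that of ψ from a to b plus that of φ
from b to c. The hypothesis of `sum_telescope` is the symmetry of ∫ ψ i∂∂̄φ ∧ Ω in ψ and φ. -/
theorem sum_pairing_cocycle {a b c : Coeffs n X} (ha : IsClosedForm a)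
    (hb : IsClosedForm b) (hc : IsClosedForm c) {ψ φ : X → ℝ} (hψ : IsSmooth n ψ)
    (hφ : IsSmooth n φ)
    (hab : ∀ e : atlas (Cn n) X, ∀ z ∈ e.1.target, b e z = a e z + ddbar ψ e z)
    (hbc : ∀ e : atlas (Cn n) X, ∀ z ∈ e.1.target, c e z = b e z + ddbar φ e z) :
    ∑ k ∈ Finset.range (n + 1), (pairing ψ (word a b c k k) + pairing φ (word a b c k k)) =
      ∑ k ∈ Finset.range (n + 1), pairing ψ (word a b c k n) +
        ∑ k ∈ Finset.range (n + 1), pairing φ (word a b c 0 k) := by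
  refine sum_telescope n (F := fun p k => pairing ψ (word a b c p k))
    (G := fun p k => pairing φ (word a b c p k)) fun k p hkp hp => ?_
  have hk : k < n := hkp.trans_lt hp
  rw [pairing_word_sub_right ha hb hc hφ hbc hψ.continuous hkp hp,
    pairing_word_sub_left ha hb hc hψ hab hφ.continuous (Nat.lt_succ_of_le hkp) hk,
    pairing_ddbar_comm hψ hφ (word_isClosedForm ha hb hc k p)]
  -- Slot p is overwritten, so the word may be lengthened to p + 1. Then slots p and k both hold b,
  -- and i∂∂̄ψ can move from one to the other.
  have h1 : Function.update (word a b c k p) ⟨p, hp⟩ (ddbar ψ) =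
      Function.update (word a b c k (p + 1)) ⟨p, hp⟩ (ddbar ψ) := by
    rw [word_succ_right a b c hkp hp, Function.update_idem]
  rw [h1]
  exact pairing_update_swap φ (by simp [word, hkp]) _

/-- The volume depends only on the class of the form. -/
theorem integral_volume_eq {a b : Coeffs n X} (ha : IsClosedForm a) (hb : IsClosedForm b)
    {ψ : X → ℝ} (hψ : IsSmooth n ψ)
    (hab : ∀ e : atlas (Cn n) X, ∀ z ∈ e.1.target, b e z = a e z + ddbar ψ e z) :
    (integral fun e z => wedge fun _ : Fin n => b e z) =
      integral fun e z => wedge fun _ : Fin n => a e z := by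
  have h : ∀ p, p ≤ n → pairing (fun _ => 1) (word a b b p n) =
      pairing (fun _ => 1) (word a b b 0 n) := fun p hp => by
    induction p with
    | zero => rfl
    | succ p ih =>
      rw [← ih (Nat.le_of_succ_le hp), eq_comm, ← sub_eq_zero,
        pairing_word_sub_left ha hb hb hψ hab continuous_const hp hp,
        -- Symmetry moves i∂∂̄ from ψ onto the constant 1, where it vanishes.
        pairing_ddbar_comm (isSmooth_const 1) hψ (word_isClosedForm ha hb hb p n)]
      have h0 : (ddbar (fun _ => 1) : Coeffs n X) = fun _ _ => 0 := by
        funext e z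
        ext j k
        simp only [ddbar, levi, inChart, Matrix.of_apply, Matrix.zero_apply]
        rw [show dzbar k (fun _ : Cn n => ((1 : ℝ) : ℂ)) = fun _ => 0 from
          funext fun w => dzbar_const _ _, dz_const]
      rw [h0]
      have h1 := pairing_update_add hψ.continuous
        (fun m => (word_isClosedForm ha hb hb p n m).isContinuousForm) ⟨p, hp⟩
        (L := fun _ _ => 0) (M := ddbar fun _ => 1) (N := ddbar fun _ => 1)
        (isClosedForm_ddbar (isSmooth_const 1)).isContinuousForm
        (isClosedForm_ddbar (isSmooth_const 1)).isContinuousForm (by simp [h0])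
      rw [h0] at h1
      linarith
  have h2 := h n le_rfl
  have e1 : word a b b n n = fun _ => a := by
    funext m
    simp [word]
  have e2 : word a b b 0 n = fun _ => b := by
    funext m
    simp [word]
  rw [e1, e2] at h2
  simpa [pairing, inChart] using h2.symm

end Cocycle

/-! ### The energy functionals -/

section Energy

variable {n : ℕ} {X : Type*} [TopologicalSpace X] [ChartedSpace (Cn n) X]

theorem eq_of_inChart_eq {u v : X → ℝ}
    (h : ∀ c : atlas (Cn n) X, ∀ z ∈ c.1.target, inChart u c z = inChart v c z) : u = v := by
  funext x
  have := h ⟨chartAt (Cn n) x, chart_mem_atlas (Cn n) x⟩ _ (mem_chart_target (Cn n) x)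
  simpa [inChart] using this

/-- The negative of the Ricci potential of `ω_φ`, up to a constant. -/
def negRicciPotential (g : Coeffs n X) (h φ : X → ℝ) (x : X) : ℝ :=
  logVolumeRatio g (perturb g φ) x - h x + φ x

variable [T2Space X] [CompactSpace X]

theorem mixedEnergy_eq (g : Coeffs n X) (φ : X → ℝ) (k : ℕ) :
    mixedEnergy g φ k = (integral fun c z => wedge fun _ : Fin n => g c z)⁻¹ *
      pairing φ (fun m : Fin n => if m.val < k then g else perturb g φ) := by
  rw [mixedEnergy, avg, pairing]
  congr 1
  refine integral_congr fun c z _ => ?_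
  rw [wedgePow]
  congr 2
  funext m
  split_ifs <;> rfl

variable [IsManifold 𝓘(ℂ, Cn n) ω X]

theorem KEnergy_eq {g : Coeffs n X} (hg : IsKahler g) {h φ : X → ℝ} (hφ : φ ∈ potentials g) :
    KEnergy g h φ = (integral fun c z => wedge fun _ : Fin n => g c z)⁻¹ *
        pairing (negRicciPotential g h φ) (fun _ => perturb g φ)
      - 1 / ((n : ℝ) + 1) * ∑ k ∈ Finset.range (n + 1), mixedEnergy g φ k
      + avg g fun c z => inChart h c z * wedge fun _ => g c z := by
  rw [KEnergy, avg, pairing]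
  congr 3
  refine integral_congr fun c z hz => ?_
  rw [logRatio_eq hg (isKahler_perturb hg hφ) c hz]
  simp only [inChart, negRicciPotential]
  ring

theorem ricci_perturb {g : Coeffs n X} (hg : IsKahler g) {h φ : X → ℝ}
    (hh : IsRicciPotential g h) (hφ : φ ∈ potentials g) (c : atlas (Cn n) X) {z : Cn n}
    (hz : z ∈ c.1.target) :
    ricci (perturb g φ) c z =
      perturb g φ c z - ddbar (negRicciPotential g h φ) c z := by
  have hg' := isKahler_perturb hg hφ
  have hL := isSmooth_logVolumeRatio hg hg'
  have h1 : ddbar (negRicciPotential g h φ) c z =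
      ricci g c z - ricci (perturb g φ) c z - ddbar h c z + ddbar φ c z := by
    rw [← ddbar_logVolumeRatio hg hg' c hz, ← ddbar_sub hL hh.smooth c hz,
      ← ddbar_add (hL.sub hh.smooth) hφ.1 c hz]
    rfl
  have h2 : ricci g c z = g c z + ddbar h c z := hh.ricci_eq c z hz
  have h3 : perturb g φ c z = g c z + ddbar φ c z := rfl
  rw [h1, h2, h3]
  abel

/-- b_k + 2 equals n + 1 for k = 0, 1 and vanishes for larger k. -/
theorem sum_bCoeff_mul (hn : 1 ≤ n) (m : ℕ → ℝ) :
    ∑ k ∈ Finset.range (n + 1), bCoeff n k / ((n : ℝ) + 1) * m k =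
      m 0 + m 1 - 2 * (1 / ((n : ℝ) + 1) * ∑ k ∈ Finset.range (n + 1), m k) := by
  obtain ⟨n, rfl⟩ := Nat.exists_eq_add_of_le' hn
  have hne : ((n + 1 : ℕ) : ℝ) + 1 ≠ 0 := by positivity
  rw [Finset.sum_range_succ', Finset.sum_range_succ', Finset.sum_range_succ' m,
    Finset.sum_range_succ' (fun k => m (k + 1))]
  simp only [bCoeff]
  simp only [zero_add, zero_le_one, le_refl, if_true,
    show ∀ k : ℕ, ¬ (k + 1 + 1 ≤ 1) from fun k => by omega, if_false, ← Finset.mul_sum]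
  field_simp
  ring

/-- Pali's inequality: `E₁ ≥ 2 ν` up to an additive constant. -/
theorem KEnergy_le_E1 (hn : 1 ≤ n) {g : Coeffs n X} (hg : IsKahler g) {h φ : X → ℝ}
    (hh : IsRicciPotential g h) (hφ : φ ∈ potentials g) :
    2 * KEnergy g h φ - 2 * (avg g fun c z => inChart h c z * wedge fun _ => g c z)
      + (avg g fun c z => inChart h c z * wedgePow 1 (ricci g c z + g c z) (g c z)) ≤
    E1 g h φ := by
  have hg' := isKahler_perturb hg hφ
  set g' := perturb g φ
  set s := negRicciPotential g h φ
  -- The weight in the first term of E₁; by construction s = w + φ.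
  set w : X → ℝ := fun x => logVolumeRatio g g' x - h x
  have hw : IsSmooth n w := (isSmooth_logVolumeRatio hg hg').sub hh.smooth
  have hs : IsSmooth n s := hw.add hφ.1
  let i : Fin n := ⟨0, hn⟩
  let p : (X → ℝ) → Coeffs n X → ℝ := fun f M => pairing f (Function.update (fun _ => g') i M)
  have hA : ∀ m : Fin n, IsClosedForm ((fun _ : Fin n => g') m) := fun _ => hg'.isClosedForm
  have hA' : ∀ m : Fin n, IsContinuousForm ((fun _ : Fin n => g') m) := fun _ =>
    hg'.isClosedForm.isContinuousForm
  have cg := hg.isClosedForm.isContinuousForm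
  have cg' := hg'.isClosedForm.isContinuousForm
  have cs := (isClosedForm_ddbar hs).isContinuousForm
  have cφ := (isClosedForm_ddbar hφ.1).isContinuousForm
  have hadd : ∀ {M : Coeffs n X}, IsContinuousForm M → p s M = p w M + p φ M := fun hM =>
    pairing_add_left hw.continuous hφ.1.continuous (isContinuousForm_update hA' i hM)
  have hR : p w (fun c z => ricci g' c z + g c z) = p w g' + p w g - p w (ddbar s) := by
    have h1 := pairing_update_add hw.continuous hA' i cg' cg (L := fun c z => g' c z + g c z)
      (fun _ _ _ => rfl)
    have h2 := pairing_update_sub hw.continuous hA' i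
      (hg'.isClosedForm.add hg.isClosedForm).isContinuousForm cs
      (L := fun c z => ricci g' c z + g c z) (fun c z hz => by
        rw [ricci_perturb hg hh hφ c hz]
        abel)
    simp only [p]
    rw [h2, h1]
  have hsg' : p s g' = p s g + p s (ddbar φ) :=
    pairing_update_add hs.continuous hA' i cg cφ fun _ _ _ => rfl
  have hcomm : p φ (ddbar s) = p s (ddbar φ) := pairing_ddbar_comm hφ.1 hs hA i
  have hnonpos : p s (ddbar s) ≤ 0 := pairing_ddbar_self_nonpos hs hg' i
  have hupd : Function.update (fun _ : Fin n => g') i g' = fun _ => g' :=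
    Function.update_eq_self i _
  set V := integral fun c z => wedge fun _ : Fin n => g c z with hV
  -- Only the sign of the normalising factor enters the inequality; V ≠ 0 is not needed.
  have hV0 : 0 ≤ V⁻¹ := inv_nonneg.2 (integral_nonneg fun c z hz =>
    wedge_nonneg fun _ => (hg.posDef c z hz).posSemidef)
  have hm0 : mixedEnergy g φ 0 = V⁻¹ * p φ g' := by
    rw [mixedEnergy_eq]
    simp only [p, hupd, Nat.not_lt_zero, if_false]
    rfl
  have hm1 : mixedEnergy g φ 1 = V⁻¹ * p φ g := by
    rw [mixedEnergy_eq]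
    congr 2
    funext m
    by_cases hm : m = i
    · subst hm
      simp [i]
    · have : m.val ≠ 0 := fun h' => hm (Fin.ext h')
      rw [Function.update_of_ne hm, if_neg (by omega)]
  have hE : (avg g fun c z => (logRatio g φ c z - inChart h c z) *
      wedgePow 1 (ricci g' c z + g c z) (g' c z)) =
      V⁻¹ * p w (fun c z => ricci g' c z + g c z) := by
    rw [avg]
    congr 1
    refine integral_congr fun c z hz => ?_
    rw [logRatio_eq hg hg' c hz, update_apply_chart, wedgePow]
    congr 2
    funext m
    by_cases hm : m = i
    · subst hm
      simp [i]
    · have : m.val ≠ 0 := fun h' => hm (Fin.ext h')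
      rw [Function.update_of_ne hm, if_neg (by omega)]
  have hK : pairing s (fun _ => g') = p s g' := by simp only [p, hupd]
  rw [E1, hE, hR, sum_bCoeff_mul hn, hm0, hm1, KEnergy_eq hg hφ, hK]
  have e1 := hadd cg
  have e2 := hadd cg'
  have e3 := hadd cs
  -- The φ-terms turn w into s against ω_φ and ω. Replacing ω by ω_φ − i∂∂̄φ yields a cross term
  -- that cancels against the one from w = s − φ in the i∂∂̄s pairing.
  have : V⁻¹ * (p w g' + p w g - p w (ddbar s)) + (V⁻¹ * p φ g' + V⁻¹ * p φ g) =
      2 * (V⁻¹ * p s g') - V⁻¹ * p s (ddbar s) := by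
    linear_combination -V⁻¹ * e1 - V⁻¹ * e2 + V⁻¹ * e3 + V⁻¹ * hcomm - V⁻¹ * hsg'
  have hpos : 0 ≤ -(V⁻¹ * p s (ddbar s)) := by
    rw [← mul_neg]
    exact mul_nonneg hV0 (neg_nonneg.2 hnonpos)
  linarith

/-- Two metrics with Ricci potentials differ by `i∂∂̄` of a function. -/
theorem eq_add_ddbar {g₀ g : Coeffs n X} (hg₀ : IsKahler g₀) (hg : IsKahler g) {h₀ h : X → ℝ}
    (hh₀ : IsRicciPotential g₀ h₀) (hh : IsRicciPotential g h) (c : atlas (Cn n) X) {z : Cn n}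
    (hz : z ∈ c.1.target) :
    g c z = g₀ c z + ddbar (fun x => h₀ x - h x - logVolumeRatio g₀ g x) c z := by
  rw [ddbar_sub (hh₀.smooth.sub hh.smooth) (isSmooth_logVolumeRatio hg₀ hg) c hz,
    ddbar_sub hh₀.smooth hh.smooth c hz, ddbar_logVolumeRatio hg₀ hg c hz]
  have h1 : ricci g₀ c z = g₀ c z + ddbar h₀ c z := hh₀.ricci_eq c z hz
  have h2 : ricci g c z = g c z + ddbar h c z := hh.ricci_eq c z hz
  rw [h1, h2]
  abel

/-- The cocycle property of the K-energy: changing the reference metric changes the K-energy by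
an additive constant. -/
theorem exists_KEnergy_eq {g₀ g : Coeffs n X} (hg₀ : IsKahler g₀) (hg : IsKahler g)
    {h₀ h : X → ℝ} (hh₀ : IsRicciPotential g₀ h₀) (hh : IsRicciPotential g h) :
    ∃ (ψ : X → ℝ) (C : ℝ), ∀ φ ∈ potentials g, (fun x => ψ x + φ x) ∈ potentials g₀ ∧
      KEnergy g h φ = KEnergy g₀ h₀ (fun x => ψ x + φ x) + C := by
  -- Adding a constant to ψ would give the same i∂∂̄ψ. This choice makes the two functions s agree
  -- exactly, by additivity of log volume ratios.
  set ψ : X → ℝ := fun x => h₀ x - h x - logVolumeRatio g₀ g x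
  have hψ : IsSmooth n ψ :=
    (hh₀.smooth.sub hh.smooth).sub (isSmooth_logVolumeRatio hg₀ hg)
  have hab : ∀ c : atlas (Cn n) X, ∀ z ∈ c.1.target, g c z = g₀ c z + ddbar ψ c z :=
    fun c z hz => eq_add_ddbar hg₀ hg hh₀ hh c hz
  set V := integral fun c z => wedge fun _ : Fin n => g c z with hV
  have hV' : (integral fun c z => wedge fun _ : Fin n => g₀ c z) = V :=
    (integral_volume_eq hg₀.isClosedForm hg.isClosedForm hψ hab).symm
  -- The φ-independent difference of the two K-energies: the Aubin–Mabuchi term of ψ and the two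
  -- averages of Ricci potentials.
  refine ⟨ψ, 1 / ((n : ℝ) + 1) * ∑ k ∈ Finset.range (n + 1), mixedEnergy g₀ ψ k
    - (avg g₀ fun c z => inChart h₀ c z * wedge fun _ => g₀ c z)
    + avg g fun c z => inChart h c z * wedge fun _ => g c z, fun φ hφ => ?_⟩
  have hc : ∀ c : atlas (Cn n) X, ∀ z ∈ c.1.target,
      perturb g₀ (fun x => ψ x + φ x) c z = perturb g φ c z := fun c z hz => by
    have h1 : perturb g₀ (fun x => ψ x + φ x) c z =
      g₀ c z + ddbar (fun x => ψ x + φ x) c z := rfl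
    have h2 : perturb g φ c z = g c z + ddbar φ c z := rfl
    rw [h1, h2, ddbar_add hψ hφ.1 c hz, hab c z hz, add_assoc]
  have hφ₀ : (fun x => ψ x + φ x) ∈ potentials g₀ :=
    ⟨hψ.add hφ.1, fun c z hz => by
      rw [hc c z hz]
      exact hφ.2 c z hz⟩
  refine ⟨hφ₀, ?_⟩
  have hg' := isKahler_perturb hg hφ
  have hg₀' := isKahler_perturb hg₀ hφ₀
  have hs : negRicciPotential g₀ h₀ (fun x => ψ x + φ x) = negRicciPotential g h φ := by
    refine eq_of_inChart_eq (n := n) fun c z hz => ?_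
    have e1 := inChart_logVolumeRatio hg₀ hg₀' c hz
    have e2 := inChart_logVolumeRatio hg hg' c hz
    have e3 := inChart_logVolumeRatio hg₀ hg c hz
    rw [hc c z hz] at e1
    simp only [inChart] at e1 e2 e3 ⊢
    have e4 : ψ (c.1.symm z) = h₀ (c.1.symm z) - h (c.1.symm z) -
        logVolumeRatio g₀ g (c.1.symm z) := rfl
    simp only [negRicciPotential, e1, e2, e4, e3]
    ring
  have hsum : ∑ k ∈ Finset.range (n + 1), mixedEnergy g₀ (fun x => ψ x + φ x) k =
      ∑ k ∈ Finset.range (n + 1), mixedEnergy g₀ ψ k +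
        ∑ k ∈ Finset.range (n + 1), mixedEnergy g φ k := by
    have h1 := sum_pairing_cocycle hg₀.isClosedForm hg.isClosedForm hg'.isClosedForm hψ hφ.1
      hab (fun _ _ _ => rfl)
    have e1 : ∀ k, mixedEnergy g₀ (fun x => ψ x + φ x) k =
        V⁻¹ * (pairing ψ (word g₀ g (perturb g φ) k k) +
          pairing φ (word g₀ g (perturb g φ) k k)) := fun k => by
      rw [mixedEnergy_eq, hV', ← pairing_add_left hψ.continuous hφ.1.continuous fun m =>
        (word_isClosedForm hg₀.isClosedForm hg.isClosedForm
          hg'.isClosedForm k k m).isContinuousForm]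
      congr 1
      refine pairing_congr fun m c z hz => ?_
      by_cases hm : m.val < k
      · simp [word, hm]
      · simp [word, hm, hc c z hz]
    have e2 : ∀ k, mixedEnergy g₀ ψ k =
        V⁻¹ * pairing ψ (word g₀ g (perturb g φ) k n) := fun k => by
      rw [mixedEnergy_eq, hV']
      congr 1
      refine pairing_congr fun m c z hz => ?_
      by_cases hm : m.val < k
      · simp [word, hm]
      · simp only [word, hm, m.2, if_true, if_false]
        exact (hab c z hz).symm
    have e3 : ∀ k, mixedEnergy g φ k =
        V⁻¹ * pairing φ (word g₀ g (perturb g φ) 0 k) := fun k => by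
      rw [mixedEnergy_eq]
      congr 2
    simp only [e1, e2, e3, ← Finset.mul_sum, ← mul_add, h1]
  rw [KEnergy_eq hg hφ, KEnergy_eq hg₀ hφ₀, hs, hsum, hV',
    pairing_congr (A := fun _ => perturb g₀ fun x => ψ x + φ x) (B := fun _ => perturb g φ)
      fun _ => hc]
  ring

end Energy

end FanoEnergy

end

/-! ### The lower bound for E₁ -/

theorem theorem1 {n : ℕ} (hn : 1 ≤ n) {X : Type*} [TopologicalSpace X] [T2Space X]
    [CompactSpace X] [ConnectedSpace X] [ChartedSpace (FanoEnergy.Cn n) X]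
    [IsManifold (modelWithCornersSelf ℂ (FanoEnergy.Cn n)) ω X]
    (hK : ∃ (g₀ : FanoEnergy.Coeffs n X) (h₀ : X → ℝ),
      FanoEnergy.IsCanonicalKahler g₀ ∧ FanoEnergy.IsRicciPotential g₀ h₀ ∧
        ∃ C : ℝ, ∀ φ ∈ FanoEnergy.potentials g₀, C ≤ FanoEnergy.KEnergy g₀ h₀ φ) :
    ∀ (g : FanoEnergy.Coeffs n X) (h : X → ℝ),
      FanoEnergy.IsCanonicalKahler g → FanoEnergy.IsRicciPotential g h →
        ∃ C : ℝ, ∀ φ ∈ FanoEnergy.potentials g, C ≤ FanoEnergy.E1 g h φ := by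
  obtain ⟨g₀, h₀, hg₀, hh₀, C₀, hC₀⟩ := hK
  intro g h hg hh
  obtain ⟨ψ, C₁, hψ⟩ := FanoEnergy.exists_KEnergy_eq hg₀.kahler hg.kahler hh₀ hh
  -- C₀ + C₁ bounds the K-energy with reference `g` from below; the remaining terms are the additive
  -- constants of `KEnergy_le_E1`.
  refine ⟨2 * (C₀ + C₁)
      - 2 * (FanoEnergy.avg g fun c z =>
          FanoEnergy.inChart h c z * FanoEnergy.wedge fun _ => g c z)
      + FanoEnergy.avg g fun c z => FanoEnergy.inChart h c z *
          FanoEnergy.wedgePow 1 (FanoEnergy.ricci g c z + g c z) (g c z), fun φ hφ =>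
    le_trans ?_ (FanoEnergy.KEnergy_le_E1 hn hg.kahler hh hφ)⟩
  have := hC₀ _ (hψ φ hφ).1
  rw [(hψ φ hφ).2]
  linarith
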